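/- **Setting.** Fix $d\ge 1$ and a *kernel* $K:[0,\infty)\to[0,\infty)$, i.e. a non-increasing, right-continuous function with $0<\int_0^\infty K(r)\,dr<\infty$; assume moreover that $\int_{\mathbb R^d}K(\|x\|)\,dx<\infty$, and for $s>0$ write $v_s=\int_{\mathbb R^d}K(\|x\|/s)\,dx\in(0,\infty)$. *Clusterings.* A clustering of a set $X$ is a set of non-empty pairwise disjoint subsets (clusters) of $X$; $S\preceq T$ means that every cluster of $S$ is contained in a cluster of $T$. A hierarchical clustering $H$ of $X$ assigns a clustering $H(r)$ to every real $r>0$ so that $H(r')\preceq H(r)$ whenever $r\le r'$. For a metric space $X$ with a Borel probability measure $\mu$ and $s,t,k>0$, let $X_{[s,k]}=\{x\in X:\int_X K(d(x,x')/s)\,d\mu(x')\ge k\}$, and let $\mathbb L(X)(s,t,k)$ be the partition of $X_{[s,k]}$ into the classes of the smallest equivalence relation on $X_{[s,k]}$ relating any two points at distance at most $t$. *Curves.* A curve is a continuous map $\gamma=(\gamma_s,\gamma_t,\gamma_k):I_\gamma\to(0,\infty)^3$ on an interval $I_\gamma=(0,\max_\gamma)$, $0<\max_\gamma\le\infty$,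 with $\gamma_s,\gamma_t$ non-increasing and $\gamma_k$ non-decreasing. For a metric probability space $X$, the $\gamma$-linkage of $X$ is the hierarchical clustering with value $\mathbb L(X)(\gamma(r))$ for $r\in I_\gamma$ and $\emptyset$ for $r\ge\max_\gamma$. The curve is *covering* if $\gamma_s$ is strictly decreasing with $\gamma_s(r)\to0$ as $r\to\max_\gamma$ and $\gamma_k$ is strictly increasing with $\gamma_k(r)\to 0$ as $r\to 0$; then $\varphi(r)=\gamma_k(r)/v_{\gamma_s(r)}$ is a bijection $I_\gamma\to(0,\infty)$, and $\overline\gamma=\gamma\circ\varphi^{-1}$ is a curve on $(0,\infty)$. A family $\{\gamma^\theta\}_{\theta\in\Theta}$ of curves is *admissible* if every $\gamma^\theta$ is covering and continuously differentiable with $(\gamma^\theta_s)',(\gamma^\theta_t)'<0$ and $(\gamma^\theta_k)'>0$ on $I_{\gamma^\theta}$, and if for every $b>0$ there is $\theta\in\Theta$ with $\gamma^\theta_s(r),\gamma^\theta_t(r)<b$ for all $r\in I_{\gamma^\theta}$. *Measured interleavings.* A correspondence $R\subseteq X\times Y$ is a subset both of whose projections $\pi_X:R\to X$, $\pi_Y:R\to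 Y$ are surjective. Let $H,E$ be hierarchical clusterings, all of whose clusters are measurable, of measure spaces $(X,\mu_X)$, $(Y,\mu_Y)$. They are *$\varepsilon$-measured-interleaved with respect to $R$* if for all $r>\varepsilon$: every $A\in H(r)$ has a (necessarily unique) $R_X(A)\in E(r-\varepsilon)$ with $\pi_X^{-1}(A)\subseteq\pi_Y^{-1}(R_X(A))$; every $B\in E(r)$ has a (necessarily unique) $R_Y(B)\in H(r-\varepsilon)$ with $\pi_Y^{-1}(B)\subseteq\pi_X^{-1}(R_Y(B))$; and $\mu_X(\bigcup_iA_i)\le\mu_Y(\bigcup_iR_X(A_i))+\varepsilon$ and $\mu_Y(\bigcup_jB_j)\le\mu_X(\bigcup_jR_Y(B_j))+\varepsilon$ for all finite collections of clusters $A_i\in H(r)$ and $B_j\in E(r)$. For subspaces $X,Y$ of a metric space, the *closest point correspondence* $R_c\subseteq X\times Y$ consists of the pairs $(x,y)$ such that $d(x,y)=\min_{y'\in Y}d(x,y')$ or $d(x,y)=\min_{x'\in X}d(x',y)$. **Theorem.** Let $\{\gamma^\theta\}_{\theta\in\Theta}$ be an admissible family of curves, and let $f:\mathbb R^d\to\mathbb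 R$ be a continuous, compactly supported probability density function. Let $\operatorname{supp}(f)=\overline{\{f\ne0\}}$ carry the measure $\mu_f$ with density $f$, and let $H(f)$ be the hierarchical clustering of $\operatorname{supp}(f)$ for which $H(f)(r)$ is the set of connected components of $\{x\in\operatorname{supp}(f):f(x)\ge r\}$. Then $\overline\gamma$-linkage is MI-consistent with respect to $f$: there are parameters $\theta_n\in\Theta$, $n\in\mathbb N$, such that for every $\varepsilon>0$, if $X_n$ is the set of points of an i.i.d. $n$-sample with distribution $\mu_f$, with the Euclidean metric and the normalized counting measure, then the probability that the $\overline{\gamma^{\theta_n}}$-linkage of $X_n$ and $H(f)$ are $\varepsilon$-measured-interleaved with respect to the closest point correspondence $R_c\subseteq X_n\times\operatorname{supp}(f)$ tends to $1$ as $n\to\infty$. -/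

import Mathlib

open Set Filter Topology MeasureTheory

noncomputable section

namespace GammaLinkage

/-- A clustering of `X`: a set of non-empty, pairwise disjoint subsets of `X`. -/
@[ext]
structure Clustering (X : Type*) where
  clusters : Set (Set X)
  nonempty : ∀ A ∈ clusters, A.Nonempty
  disjoint : clusters.PairwiseDisjoint id

namespace Clustering

variable {X Y : Type*}

theorem eq_of_mem (S : Clustering X) {A B : Set X} (hA : A ∈ S.clusters) (hB : B ∈ S.clusters)
    {x : X} (hxA : x ∈ A) (hxB : x ∈ B) : A = B := by
  by_contra h
  exact Set.disjoint_left.1 (S.disjoint hA hB h) hxA hxB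

/-- The poset of clusterings: every cluster of `S` is contained in a cluster of `T`. -/
instance : PartialOrder (Clustering X) where
  le S T := ∀ A ∈ S.clusters, ∃ B ∈ T.clusters, A ⊆ B
  le_refl S A hA := ⟨A, hA, subset_rfl⟩
  le_trans S T U h₁ h₂ A hA := by
    obtain ⟨B, hB, hAB⟩ := h₁ A hA
    obtain ⟨C, hC, hBC⟩ := h₂ B hB
    exact ⟨C, hC, hAB.trans hBC⟩
  le_antisymm S T h₁ h₂ := by
    have key : ∀ S T : Clustering X, (∀ A ∈ S.clusters, ∃ B ∈ T.clusters, A ⊆ B) →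
        (∀ A ∈ T.clusters, ∃ B ∈ S.clusters, A ⊆ B) → S.clusters ⊆ T.clusters := by
      intro S T h₁ h₂ A hA
      obtain ⟨B, hB, hAB⟩ := h₁ A hA
      obtain ⟨C, hC, hBC⟩ := h₂ B hB
      obtain ⟨x, hx⟩ := S.nonempty A hA
      have hAC : A = C := S.eq_of_mem hA hC hx (hBC (hAB hx))
      have hEq : A = B := hAB.antisymm (hAC ▸ hBC)
      exact hEq ▸ hB
    exact Clustering.ext ((key S T h₁ h₂).antisymm (key T S h₂ h₁))

/-- The empty clustering. -/
def empty (X : Type*) : Clustering X where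
  clusters := ∅
  nonempty := by simp
  disjoint := by simp

theorem empty_le (S : Clustering X) : empty X ≤ S := fun _ hA => absurd hA (Set.notMem_empty _)

/-- The pullback `ψ^*(S) = {ψ⁻¹(C) : C ∈ S}`. (Empty preimages are discarded; there are none when
`ψ` is surjective, as the projections of a correspondence are.) -/
def pullback (ψ : Y → X) (S : Clustering X) : Clustering Y where
  clusters := {B | B.Nonempty ∧ ∃ C ∈ S.clusters, B = ψ ⁻¹' C}
  nonempty _ hB := hB.1
  disjoint := by
    rintro _ ⟨-, C, hC, rfl⟩ _ ⟨-, D, hD, rfl⟩ hne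
    have hCD : C ≠ D := fun h => hne (h ▸ rfl)
    exact Disjoint.preimage ψ (S.disjoint hC hD hCD)

theorem pullback_mono (ψ : Y → X) : Monotone (pullback ψ) := by
  rintro S T h _ ⟨⟨y, hy⟩, C, hC, rfl⟩
  obtain ⟨D, hD, hCD⟩ := h C hC
  exact ⟨ψ ⁻¹' D, ⟨⟨y, hCD hy⟩, D, hD, rfl⟩, Set.preimage_mono hCD⟩

/-- A clustering of a subset `U` of `X`, regarded as a clustering of `X`. -/
def ofSubset (U : Set X) (S : Clustering U) : Clustering X where
  clusters := (fun A : Set U => Subtype.val '' A) '' S.clusters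
  nonempty := by
    rintro _ ⟨A, hA, rfl⟩
    exact (S.nonempty A hA).image _
  disjoint := by
    rintro _ ⟨A, hA, rfl⟩ _ ⟨B, hB, rfl⟩ hne
    have hAB : A ≠ B := fun h => hne (h ▸ rfl)
    exact (Set.disjoint_image_iff Subtype.val_injective).2 (S.disjoint hA hB hAB)

end Clustering

/-- The strictly positive real numbers. -/
abbrev PosReal : Type := {r : ℝ // 0 < r}

/-- A (contravariant, one-parameter) hierarchical clustering of `X`. -/
abbrev HierarchicalClustering (X : Type*) : Type _ := PosRealᵒᵈ →o Clustering X

/-- A `(1,1,-1)`-hierarchical clustering of `X`. -/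
abbrev HierarchicalClustering₃ (X : Type*) : Type _ :=
  PosReal × PosReal × PosRealᵒᵈ →o Clustering X

namespace HierarchicalClustering

variable {X Y : Type*}

/-- The clustering at scale `r > 0`. -/
def at' (H : HierarchicalClustering X) (r : ℝ) (hr : 0 < r) : Clustering X :=
  H (OrderDual.toDual ⟨r, hr⟩)

/-- The pullback of a hierarchical clustering along a function. -/
def pullback (ψ : Y → X) (H : HierarchicalClustering X) : HierarchicalClustering Y where
  toFun r := (H r).pullback ψ
  monotone' _ _ h := Clustering.pullback_mono ψ (H.monotone h)

/-- All clusters are measurable sets. -/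
def IsMeasurable [MeasurableSpace X] (H : HierarchicalClustering X) : Prop :=
  ∀ (r : ℝ) (hr : 0 < r), ∀ A ∈ (H.at' r hr).clusters, MeasurableSet A

/-- `ε`-interleaved hierarchical clusterings of the same set. -/
def Interleaved (H E : HierarchicalClustering X) (ε : ℝ) : Prop :=
  ∀ (r : ℝ) (hr : 0 < r) (hrε : 0 < r - ε),
    H.at' r hr ≤ E.at' (r - ε) hrε ∧ E.at' r hr ≤ H.at' (r - ε) hrε

end HierarchicalClustering

/-- `R ⊆ X × Y` is a correspondence: both projections are surjective. -/
def IsCorrespondence {X Y : Type*} (R : Set (X × Y)) : Prop :=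
  (∀ x, ∃ y, (x, y) ∈ R) ∧ (∀ y, ∃ x, (x, y) ∈ R)

/-- `ε`-interleaved with respect to the correspondence `R`: the pullbacks to `R` are
`ε`-interleaved. -/
def InterleavedWrt {X Y : Type*} (H : HierarchicalClustering X) (E : HierarchicalClustering Y)
    (R : Set (X × Y)) (ε : ℝ) : Prop :=
  IsCorrespondence R ∧
    HierarchicalClustering.Interleaved
      (HierarchicalClustering.pullback (fun p : R => p.1.1) H)
      (HierarchicalClustering.pullback (fun p : R => p.1.2) E) ε

/-- The relation `B = R_X(A)`, that is `π_X⁻¹(A) ⊆ π_Y⁻¹(B)`. For an interleaving with respect to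
the correspondence `R`, each `A ∈ H(r)` has exactly one such `B ∈ E(r - ε)`. -/
def Transports {X Y : Type*} (R : Set (X × Y)) (A : Set X) (B : Set Y) : Prop :=
  ∀ p ∈ R, p.1 ∈ A → p.2 ∈ B

/-- `(ε; m)`-measured-interleaved with respect to the correspondence `R`. -/
def MeasuredInterleavedWrt {X Y : Type*} [MeasurableSpace X] [MeasurableSpace Y]
    (μ : Measure X) (ν : Measure Y)
    (H : HierarchicalClustering X) (E : HierarchicalClustering Y)
    (R : Set (X × Y)) (ε m : ℝ) : Prop :=
  H.IsMeasurable ∧ E.IsMeasurable ∧ InterleavedWrt H E R ε ∧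
    ∀ (r : ℝ) (hr : 0 < r) (hrε : 0 < r - ε) (N : ℕ),
      (∀ (A : Fin N → Set X) (B : Fin N → Set Y),
        (∀ i, A i ∈ (H.at' r hr).clusters) → (∀ i, B i ∈ (E.at' (r - ε) hrε).clusters) →
        (∀ i, Transports R (A i) (B i)) →
        μ (⋃ i, A i) ≤ ν (⋃ i, B i) + ENNReal.ofReal m) ∧
      (∀ (B : Fin N → Set Y) (A : Fin N → Set X),
        (∀ i, B i ∈ (E.at' r hr).clusters) → (∀ i, A i ∈ (H.at' (r - ε) hrε).clusters) →
        (∀ i, Transports (Prod.swap ⁻¹' R) (B i) (A i)) →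
        ν (⋃ i, B i) ≤ μ (⋃ i, A i) + ENNReal.ofReal m)

/-- The closest point correspondence of two spaces embedded in a common metric space. -/
def closestPointCorrespondence {X Y Z : Type*} [MetricSpace Z] (i : X → Z) (j : Y → Z) :
    Set (X × Y) :=
  {p | (∀ y', dist (i p.1) (j p.2) ≤ dist (i p.1) (j y')) ∨
    (∀ x', dist (i p.1) (j p.2) ≤ dist (i x') (j p.2))}

/-- The single-linkage covariant hierarchical clustering: at scale `t` the classes of the smallest
equivalence relation relating points at distance at most `t`. -/
def singleLinkage (X : Type*) [MetricSpace X] : PosReal →o Clustering X where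
  toFun t :=
    { clusters := (Relation.EqvGen.setoid fun x y : X => dist x y ≤ t.1).classes
      nonempty := fun A hA =>
        Set.nonempty_iff_ne_empty.2 fun h => Setoid.empty_notMem_classes (h ▸ hA)
      disjoint := (Setoid.isPartition_classes _).pairwiseDisjoint }
  monotone' := by
    rintro t t' h _ ⟨y, rfl⟩
    refine ⟨_, ⟨y, rfl⟩, fun x hx => ?_⟩
    exact Relation.EqvGen.mono (r := fun a b => dist a b ≤ t.1)
      (fun a b (hab : dist a b ≤ t.1) => hab.trans h) x y hx

/-- Kernels: non-increasing, right-continuous `K : ℝ_{≥0} → ℝ_{≥0}` with `0 < ∫ K < ∞`. Only the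
values on `[0, ∞)` matter. -/
structure DensityKernel where
  toFun : ℝ → ℝ
  nonneg : ∀ r, 0 ≤ r → 0 ≤ toFun r
  antitoneOn : AntitoneOn toFun (Ici 0)
  rightContinuous : ∀ r, 0 ≤ r → ContinuousWithinAt toFun (Ici r) r
  integrableOn : IntegrableOn toFun (Ioi 0)
  integral_pos : 0 < ∫ r in Ioi (0 : ℝ), toFun r

instance : CoeFun DensityKernel fun _ => ℝ → ℝ := ⟨DensityKernel.toFun⟩

theorem DensityKernel.measurable_comp {X : Type*} [MeasurableSpace X] (K : DensityKernel)
    {g : X → ℝ} (hg : Measurable g) (h0 : ∀ x, 0 ≤ g x) : Measurable fun x => K (g x) := by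
  have h1 : Antitone fun r : ℝ => K (max r 0) := fun a b hab =>
    K.antitoneOn (le_max_right a 0) (le_max_right b 0) (max_le_max_right 0 hab)
  have h2 := h1.measurable.comp hg
  convert h2 using 2 with x
  simp [max_eq_left (h0 x)]

theorem DensityKernel.integrable_comp {X : Type*} [MeasurableSpace X] (K : DensityKernel)
    (μ : Measure X) [IsFiniteMeasure μ]
    {g : X → ℝ} (hg : Measurable g) (h0 : ∀ x, 0 ≤ g x) : Integrable (fun x => K (g x)) μ := by
  refine Integrable.of_bound (K.measurable_comp hg h0).aestronglyMeasurable (K 0)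
    (ae_of_all _ fun x => ?_)
  rw [Real.norm_of_nonneg (K.nonneg _ (h0 x))]
  exact K.antitoneOn (mem_Ici.2 le_rfl) (h0 x) (h0 x)

section KernelLinkage

variable {X : Type*} [MetricSpace X] [MeasurableSpace X]

/-- The local density estimate at scale `s`. -/
def localDensity (K : DensityKernel) (μ : Measure X) (s : ℝ) (x : X) : ℝ :=
  ∫ x', K (dist x x' / s) ∂μ

/-- The kernel filtration `X_{[s,k]}`. -/
def kernelFiltration (K : DensityKernel) (μ : Measure X) (s k : ℝ) : Set X :=
  {x | k ≤ localDensity K μ s x}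

variable [BorelSpace X]

theorem kernelFiltration_mono (K : DensityKernel) (μ : Measure X) [IsFiniteMeasure μ]
    {s s' k k' : ℝ} (hs : 0 < s) (hss' : s ≤ s') (hk : k' ≤ k) :
    kernelFiltration K μ s k ⊆ kernelFiltration K μ s' k' := by
  intro x hx
  have hs' := hs.trans_le hss'
  refine hk.trans (le_trans hx (integral_mono ?_ ?_ fun y => ?_))
  · exact K.integrable_comp μ (by fun_prop) fun y => div_nonneg dist_nonneg hs.le
  · exact K.integrable_comp μ (by fun_prop) fun y => div_nonneg dist_nonneg hs'.le
  · exact K.antitoneOn (div_nonneg dist_nonneg hs'.le) (div_nonneg dist_nonneg hs.le)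
      (div_le_div_of_nonneg_left dist_nonneg hs hss')

/-- The kernel linkage `𝕃^K(X)`, sending `(s,t,k)` to the single-linkage clustering of the
subspace `X_{[s,k]}` at scale `t`. -/
def kernelLinkage (K : DensityKernel) (μ : Measure X) [IsFiniteMeasure μ] :
    HierarchicalClustering₃ X where
  toFun p := Clustering.ofSubset (kernelFiltration K μ p.1.1 (OrderDual.ofDual p.2.2).1)
    (singleLinkage _ p.2.1)
  monotone' := by
    rintro ⟨s, t, k⟩ ⟨s', t', k'⟩ ⟨hs, ht, hk⟩ _ ⟨_, ⟨y, rfl⟩, rfl⟩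
    have hsub : kernelFiltration K μ s.1 (OrderDual.ofDual k).1 ⊆
        kernelFiltration K μ s'.1 (OrderDual.ofDual k').1 := kernelFiltration_mono K μ s.2 hs hk
    refine ⟨_, ⟨_, ⟨Set.inclusion hsub y, rfl⟩, rfl⟩, ?_⟩
    rintro _ ⟨x, hx, rfl⟩
    refine ⟨Set.inclusion hsub x, ?_, rfl⟩
    have hx' : Relation.EqvGen (fun a b => dist a b ≤ t.1) x y := hx
    change Relation.EqvGen (fun a b => dist a b ≤ t'.1) (Set.inclusion hsub x)
      (Set.inclusion hsub y)
    clear hx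
    induction hx' with
    | rel a b hab => exact .rel _ _ (le_trans (show dist a b ≤ t.1 from hab) ht)
    | refl a => exact .refl _
    | symm a b _ ih => exact .symm _ _ ih
    | trans a b c _ _ ih₁ ih₂ => exact .trans _ _ _ ih₁ ih₂

end KernelLinkage

/-- A curve in the `(1,1,-1)`-parameter space, defined on the interval `(0, max)` with
`0 < max ≤ ∞`. Only the values of `s`, `t`, `k` on that interval matter. -/
structure ParamCurve where
  max : EReal
  max_pos : 0 < max
  s : ℝ → ℝ
  t : ℝ → ℝ
  k : ℝ → ℝ
  s_pos : ∀ r : ℝ, 0 < r → r < max → 0 < s r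
  t_pos : ∀ r : ℝ, 0 < r → r < max → 0 < t r
  k_pos : ∀ r : ℝ, 0 < r → r < max → 0 < k r
  s_cont : ContinuousOn s {r : ℝ | 0 < r ∧ r < max}
  t_cont : ContinuousOn t {r : ℝ | 0 < r ∧ r < max}
  k_cont : ContinuousOn k {r : ℝ | 0 < r ∧ r < max}
  s_anti : AntitoneOn s {r : ℝ | 0 < r ∧ r < max}
  t_anti : AntitoneOn t {r : ℝ | 0 < r ∧ r < max}
  k_mono : MonotoneOn k {r : ℝ | 0 < r ∧ r < max}

namespace ParamCurve

/-- The interval `I_γ = (0, max_γ)`. -/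
def dom (γ : ParamCurve) : Set ℝ := {r : ℝ | 0 < r ∧ r < γ.max}

open Classical in
/-- The slice `H^γ`: `H(γ(r))` for `r ∈ I_γ`, and the empty clustering for `r ≥ max_γ`. -/
def slice {X : Type*} (γ : ParamCurve) (H : HierarchicalClustering₃ X) :
    HierarchicalClustering X where
  toFun r :=
    if h : ((OrderDual.ofDual r).1 : EReal) < γ.max then
      H (⟨γ.s (OrderDual.ofDual r).1, γ.s_pos _ (OrderDual.ofDual r).2 h⟩,
        ⟨γ.t (OrderDual.ofDual r).1, γ.t_pos _ (OrderDual.ofDual r).2 h⟩,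
        OrderDual.toDual ⟨γ.k (OrderDual.ofDual r).1, γ.k_pos _ (OrderDual.ofDual r).2 h⟩)
    else Clustering.empty X
  monotone' := by
    intro r r' hrr'
    have hle : (OrderDual.ofDual r').1 ≤ (OrderDual.ofDual r).1 := hrr'
    by_cases h : ((OrderDual.ofDual r).1 : EReal) < γ.max
    · have h' : ((OrderDual.ofDual r').1 : EReal) < γ.max :=
        lt_of_le_of_lt (EReal.coe_le_coe_iff.2 hle) h
      simp only [h, h', dif_pos]
      have m : (OrderDual.ofDual r).1 ∈ γ.dom := ⟨(OrderDual.ofDual r).2, h⟩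
      have m' : (OrderDual.ofDual r').1 ∈ γ.dom := ⟨(OrderDual.ofDual r').2, h'⟩
      exact H.monotone ⟨γ.s_anti m' m hle, γ.t_anti m' m hle, γ.k_mono m' m hle⟩
    · simp only [h, dif_neg, not_false_eq_true]
      exact Clustering.empty_le _

/-- Covering curves. The filter `atTop` on the open interval `I_γ` is `r → max_γ`. -/
structure Covering (γ : ParamCurve) : Prop where
  s_strictAnti : StrictAntiOn γ.s γ.dom
  s_tendsto : Tendsto (fun r : γ.dom => γ.s r) atTop (𝓝 0)
  k_strictMono : StrictMonoOn γ.k γ.dom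
  k_tendsto : Tendsto γ.k (𝓝[>] 0) (𝓝 0)

/-- Curves that are non-singular in each component. -/
structure NonSingular (γ : ParamCurve) : Prop where
  s_contDiff : ContDiffOn ℝ 1 γ.s γ.dom
  t_contDiff : ContDiffOn ℝ 1 γ.t γ.dom
  k_contDiff : ContDiffOn ℝ 1 γ.k γ.dom
  s_deriv : ∀ r ∈ γ.dom, deriv γ.s r < 0
  t_deriv : ∀ r ∈ γ.dom, deriv γ.t r < 0
  k_deriv : ∀ r ∈ γ.dom, 0 < deriv γ.k r

end ParamCurve

/-- Admissible families of curves. -/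
structure AdmissibleFamily {Θ : Type*} (γ : Θ → ParamCurve) : Prop where
  covering : ∀ θ, (γ θ).Covering
  nonSingular : ∀ θ, (γ θ).NonSingular
  small : ∀ b : ℝ, 0 < b → ∃ θ, ∀ r ∈ (γ θ).dom, (γ θ).s r < b ∧ (γ θ).t r < b

/-- Euclidean space `ℝ^d`. -/
abbrev E (d : ℕ) : Type := EuclideanSpace ℝ (Fin d)

/-- `v_s = ∫_{ℝ^d} K(‖x‖/s) dx`. -/
def kernelVolume (d : ℕ) (K : DensityKernel) (s : ℝ) : ℝ := ∫ x : E d, K (‖x‖ / s)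

/-- `v_1 < ∞` (equivalently `v_s < ∞` for all `s > 0`); automatic for `d = 1`. -/
def DensityKernel.FiniteVolume (d : ℕ) (K : DensityKernel) : Prop :=
  Integrable fun x : E d => K ‖x‖

theorem kernelVolume_eq (d : ℕ) (K : DensityKernel) {s : ℝ} (hs : 0 < s) :
    kernelVolume d K s = s ^ d * kernelVolume d K 1 := by
  have h := Measure.integral_comp_inv_smul_of_nonneg (volume : Measure (E d))
    (fun x => K ‖x‖) hs.le
  simp only [finrank_euclideanSpace, Fintype.card_fin, smul_eq_mul] at h
  simp only [kernelVolume, div_one]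
  rw [← h]
  refine integral_congr_ae (ae_of_all _ fun x => ?_)
  simp only [norm_smul, norm_inv, Real.norm_of_nonneg hs.le]
  rw [div_eq_inv_mul]

theorem DensityKernel.zero_pos (K : DensityKernel) : 0 < K 0 := by
  by_contra h
  have h0 : ∀ r ∈ Ioi (0 : ℝ), K r = 0 := fun r (hr : 0 < r) =>
    le_antisymm ((K.antitoneOn (mem_Ici.2 le_rfl) hr.le hr.le).trans (not_lt.1 h))
      (K.nonneg r hr.le)
  have h1 := K.integral_pos
  rw [setIntegral_congr_fun measurableSet_Ioi h0] at h1
  simp at h1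

theorem kernelVolume_one_pos {d : ℕ} {K : DensityKernel} (hK : K.FiniteVolume d) :
    0 < kernelVolume d K 1 := by
  simp only [kernelVolume, div_one]
  rw [integral_pos_iff_support_of_nonneg (fun x => K.nonneg _ (norm_nonneg x)) hK]
  have h1 : ∀ᶠ r in 𝓝[≥] (0 : ℝ), 0 < K r :=
    (K.rightContinuous 0 le_rfl).eventually (lt_mem_nhds K.zero_pos)
  have h2 : Tendsto (fun x : E d => ‖x‖) (𝓝 0) (𝓝[≥] (0 : ℝ)) := by
    refine tendsto_nhdsWithin_iff.2 ⟨?_, Eventually.of_forall fun x => norm_nonneg x⟩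
    simpa using (continuous_norm (E := E d)).tendsto 0
  refine Measure.measure_pos_of_mem_nhds volume (x := 0) ?_
  filter_upwards [h2.eventually h1] with x hx using hx.ne'

theorem kernelVolume_pos {d : ℕ} {K : DensityKernel} (hK : K.FiniteVolume d) {s : ℝ}
    (hs : 0 < s) : 0 < kernelVolume d K s := by
  rw [kernelVolume_eq d K hs]
  exact mul_pos (pow_pos hs d) (kernelVolume_one_pos hK)

namespace ParamCurve

/-- `φ(r) = γ_k(r) / v_{γ_s(r)}`. -/
def phi (γ : ParamCurve) (d : ℕ) (K : DensityKernel) (r : ℝ) : ℝ :=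
  γ.k r / kernelVolume d K (γ.s r)

variable {γ : ParamCurve} {d : ℕ} {K : DensityKernel}

theorem dom_lt_mem {r r' : ℝ} (hr : r ∈ γ.dom) (h0 : 0 < r') (h : r' ≤ r) : r' ∈ γ.dom :=
  ⟨h0, lt_of_le_of_lt (EReal.coe_le_coe_iff.2 h) hr.2⟩

theorem ordConnected_dom : γ.dom.OrdConnected :=
  ⟨fun _ hx _ hy _ hz => dom_lt_mem hy (lt_of_lt_of_le hx.1 hz.1) hz.2⟩

theorem dom_nonempty : γ.dom.Nonempty := by
  obtain ⟨r, h0, h1⟩ := EReal.lt_iff_exists_real_btwn.1 γ.max_pos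
  exact ⟨r, by exact_mod_cast h0, h1⟩

theorem phi_pos (hK : K.FiniteVolume d) {r : ℝ} (hr : r ∈ γ.dom) : 0 < γ.phi d K r :=
  div_pos (γ.k_pos r hr.1 hr.2) (kernelVolume_pos hK (γ.s_pos r hr.1 hr.2))

theorem phi_strictMonoOn (hγ : γ.Covering) (hK : K.FiniteVolume d) :
    StrictMonoOn (γ.phi d K) γ.dom := by
  intro a ha b hb hab
  have hsa := γ.s_pos a ha.1 ha.2
  have hsb := γ.s_pos b hb.1 hb.2
  refine div_lt_div₀ (hγ.k_strictMono ha hb hab) ?_ (γ.k_pos b hb.1 hb.2).le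
    (kernelVolume_pos hK hsb)
  rw [kernelVolume_eq d K hsa, kernelVolume_eq d K hsb]
  exact mul_le_mul_of_nonneg_right (pow_le_pow_left₀ hsb.le (γ.s_anti ha hb hab.le) d)
    (kernelVolume_one_pos hK).le

theorem phi_continuousOn (hK : K.FiniteVolume d) : ContinuousOn (γ.phi d K) γ.dom := by
  have h : ContinuousOn (fun r => γ.k r / (γ.s r ^ d * kernelVolume d K 1)) γ.dom := by
    refine ContinuousOn.div γ.k_cont ((γ.s_cont.pow d).mul continuousOn_const) fun r hr => ?_
    exact (mul_pos (pow_pos (γ.s_pos r hr.1 hr.2) d) (kernelVolume_one_pos hK)).ne'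
  refine h.congr fun r hr => ?_
  simp only [phi]
  rw [kernelVolume_eq d K (γ.s_pos r hr.1 hr.2)]

theorem phi_surjOn (hd : 0 < d) (hγ : γ.Covering) (hK : K.FiniteVolume d) :
    SurjOn (γ.phi d K) γ.dom (Ioi 0) := by
  intro y hy
  have hy : 0 < y := hy
  have hv := kernelVolume_one_pos hK
  obtain ⟨r₀, hr₀⟩ := γ.dom_nonempty
  have hs₀ := γ.s_pos r₀ hr₀.1 hr₀.2
  have hk₀ := γ.k_pos r₀ hr₀.1 hr₀.2
  have hlow : ∃ a ∈ γ.dom, γ.phi d K a ≤ y := by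
    have h1 : ∀ᶠ r in 𝓝[>] (0 : ℝ), γ.k r < y * kernelVolume d K (γ.s r₀) :=
      hγ.k_tendsto.eventually (gt_mem_nhds (mul_pos hy (kernelVolume_pos hK hs₀)))
    have h2 : ∀ᶠ r in 𝓝[>] (0 : ℝ), r ∈ Ioo 0 r₀ := Ioo_mem_nhdsGT hr₀.1
    obtain ⟨a, ha1, ha2⟩ := (h1.and h2).exists
    have ha := dom_lt_mem hr₀ ha2.1 ha2.2.le
    have hsa := γ.s_pos a ha.1 ha.2
    refine ⟨a, ha, (div_le_iff₀ (kernelVolume_pos hK hsa)).2 (ha1.le.trans ?_)⟩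
    refine mul_le_mul_of_nonneg_left ?_ hy.le
    rw [kernelVolume_eq d K hsa, kernelVolume_eq d K hs₀]
    exact mul_le_mul_of_nonneg_right (pow_le_pow_left₀ hs₀.le (γ.s_anti ha hr₀ ha2.2.le) d) hv.le
  have hhigh : ∃ b ∈ γ.dom, y ≤ γ.phi d K b := by
    have : Nonempty γ.dom := ⟨⟨r₀, hr₀⟩⟩
    have h1 : Tendsto (fun r : γ.dom => y * (γ.s r ^ d * kernelVolume d K 1)) atTop (𝓝 0) := by
      have := ((hγ.s_tendsto.pow d).mul_const (kernelVolume d K 1)).const_mul y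
      simpa [hd.ne'] using this
    have h2 := h1.eventually (gt_mem_nhds hk₀)
    obtain ⟨b, hb1, hb2⟩ := (h2.and (eventually_ge_atTop (⟨r₀, hr₀⟩ : γ.dom))).exists
    have hsb := γ.s_pos b.1 b.2.1 b.2.2
    refine ⟨b, b.2, (le_div_iff₀ (kernelVolume_pos hK hsb)).2 ?_⟩
    rw [kernelVolume_eq d K hsb]
    exact hb1.le.trans (γ.k_mono hr₀ b.2 hb2)
  obtain ⟨a, ha, hay⟩ := hlow
  obtain ⟨b, hb, hby⟩ := hhigh
  exact (ordConnected_dom.isPreconnected).intermediate_value ha hb (phi_continuousOn hK)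
    ⟨hay, hby⟩

/-- The inverse of the bijection `φ : I_γ → (0, ∞)`. -/
def phiInv (γ : ParamCurve) (d : ℕ) (K : DensityKernel) : ℝ → ℝ :=
  Function.invFunOn (γ.phi d K) γ.dom

theorem phiInv_mem (hd : 0 < d) (hγ : γ.Covering) (hK : K.FiniteVolume d) {y : ℝ} (hy : 0 < y) :
    γ.phiInv d K y ∈ γ.dom := Function.invFunOn_mem (phi_surjOn hd hγ hK hy)

theorem phi_phiInv (hd : 0 < d) (hγ : γ.Covering) (hK : K.FiniteVolume d) {y : ℝ} (hy : 0 < y) :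
    γ.phi d K (γ.phiInv d K y) = y := Function.invFunOn_eq (phi_surjOn hd hγ hK hy)

theorem phiInv_strictMonoOn (hd : 0 < d) (hγ : γ.Covering) (hK : K.FiniteVolume d) :
    StrictMonoOn (γ.phiInv d K) (Ioi 0) := by
  intro a ha b hb hab
  rw [← (phi_strictMonoOn hγ hK).lt_iff_lt (phiInv_mem hd hγ hK ha) (phiInv_mem hd hγ hK hb),
    phi_phiInv hd hγ hK ha, phi_phiInv hd hγ hK hb]
  exact hab

theorem phiInv_image (hd : 0 < d) (hγ : γ.Covering) (hK : K.FiniteVolume d) :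
    γ.phiInv d K '' Ioi 0 = γ.dom := by
  refine Subset.antisymm ?_ fun r hr => ⟨γ.phi d K r, phi_pos hK hr, ?_⟩
  · rintro _ ⟨y, hy, rfl⟩
    exact phiInv_mem hd hγ hK hy
  · exact (phi_strictMonoOn hγ hK).injOn (phiInv_mem hd hγ hK (phi_pos hK hr)) hr
      (phi_phiInv hd hγ hK (phi_pos hK hr))

theorem isOpen_dom : IsOpen γ.dom :=
  isOpen_Ioi.inter (isOpen_Iio.preimage continuous_coe_real_ereal)

theorem phiInv_continuousOn (hd : 0 < d) (hγ : γ.Covering) (hK : K.FiniteVolume d) :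
    ContinuousOn (γ.phiInv d K) (Ioi 0) := by
  intro y hy
  refine ContinuousAt.continuousWithinAt ?_
  refine (phiInv_strictMonoOn hd hγ hK).continuousAt_of_image_mem_nhds (Ioi_mem_nhds hy) ?_
  rw [phiInv_image hd hγ hK]
  exact isOpen_dom.mem_nhds (phiInv_mem hd hγ hK hy)

/-- The reparametrized curve `γ̄ = γ ∘ φ⁻¹`, defined on `(0, ∞)`. -/
def reparam (γ : ParamCurve) {d : ℕ} (hd : 0 < d) (hγ : γ.Covering) {K : DensityKernel}
    (hK : K.FiniteVolume d) : ParamCurve where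
  max := ⊤
  max_pos := EReal.zero_lt_top
  s := γ.s ∘ γ.phiInv d K
  t := γ.t ∘ γ.phiInv d K
  k := γ.k ∘ γ.phiInv d K
  s_pos _ h _ := γ.s_pos _ (phiInv_mem hd hγ hK h).1 (phiInv_mem hd hγ hK h).2
  t_pos _ h _ := γ.t_pos _ (phiInv_mem hd hγ hK h).1 (phiInv_mem hd hγ hK h).2
  k_pos _ h _ := γ.k_pos _ (phiInv_mem hd hγ hK h).1 (phiInv_mem hd hγ hK h).2
  s_cont := γ.s_cont.comp ((phiInv_continuousOn hd hγ hK).mono fun _ h => h.1)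
    fun _ h => phiInv_mem hd hγ hK h.1
  t_cont := γ.t_cont.comp ((phiInv_continuousOn hd hγ hK).mono fun _ h => h.1)
    fun _ h => phiInv_mem hd hγ hK h.1
  k_cont := γ.k_cont.comp ((phiInv_continuousOn hd hγ hK).mono fun _ h => h.1)
    fun _ h => phiInv_mem hd hγ hK h.1
  s_anti _ ha _ hb hab := γ.s_anti (phiInv_mem hd hγ hK ha.1) (phiInv_mem hd hγ hK hb.1)
    ((phiInv_strictMonoOn hd hγ hK).monotoneOn ha.1 hb.1 hab)
  t_anti _ ha _ hb hab := γ.t_anti (phiInv_mem hd hγ hK ha.1) (phiInv_mem hd hγ hK hb.1)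
    ((phiInv_strictMonoOn hd hγ hK).monotoneOn ha.1 hb.1 hab)
  k_mono _ ha _ hb hab := γ.k_mono (phiInv_mem hd hγ hK ha.1) (phiInv_mem hd hγ hK hb.1)
    ((phiInv_strictMonoOn hd hγ hK).monotoneOn ha.1 hb.1 hab)

end ParamCurve

/-- The normalized counting measure of a finite space (the zero measure on the empty space). -/
def normalizedCount (X : Type*) [MeasurableSpace X] : Measure X :=
  (Nat.card X : ENNReal)⁻¹ • Measure.count

instance (X : Type*) [MeasurableSpace X] [MeasurableSingletonClass X] [Finite X] :
    IsFiniteMeasure (normalizedCount X) := by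
  constructor
  rcases isEmpty_or_nonempty X with h | h
  · simp [Set.eq_empty_of_isEmpty (Set.univ : Set X)]
  · have h1 : (Nat.card X : ENNReal) ≠ 0 := by
      exact_mod_cast Nat.card_pos.ne'
    simp only [normalizedCount, Measure.smul_apply, smul_eq_mul]
    exact ENNReal.mul_lt_top (ENNReal.inv_lt_top.2 (pos_iff_ne_zero.2 h1))
      (Measure.count_apply_lt_top.2 Set.finite_univ)

/-- A hierarchical clustering algorithm with parameter space `Θ` assigns a hierarchical clustering
to each parameter and each finite metric space (carrying its Borel σ-algebra). -/
abbrev HCAlgorithm (Θ : Type*) : Type _ :=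
  Θ → ∀ (X : Type) [MetricSpace X] [Finite X] [MeasurableSpace X] [BorelSpace X],
    HierarchicalClustering X

/-- The algorithm `γ̄`-linkage: a finite metric space, with its normalized counting measure, is sent
to the slice of its kernel linkage by the reparametrized curve `γ̄^θ`. -/
def gammaBarLinkage {Θ : Type*} {d : ℕ} (hd : 0 < d) {K : DensityKernel} (hK : K.FiniteVolume d)
    (γ : Θ → ParamCurve) (hγ : AdmissibleFamily γ) : HCAlgorithm Θ :=
  fun θ X _ _ _ _ =>
    ((γ θ).reparam hd (hγ.covering θ) hK).slice (kernelLinkage K (normalizedCount X))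

/-- Probability density functions on `ℝ^d`. -/
structure IsProbabilityDensity {d : ℕ} (f : E d → ℝ) : Prop where
  nonneg : ∀ x, 0 ≤ f x
  integrable : Integrable f
  integral_eq_one : ∫ x, f x = 1

/-- The measure `μ_f` on `supp(f)` with density `f`. -/
def densityMeasure {d : ℕ} (f : E d → ℝ) : Measure (tsupport f) :=
  (volume.withDensity fun x => ENNReal.ofReal (f x)).comap Subtype.val

/-- The density-contour hierarchical clustering `H(f)` of `supp(f)`: at scale `r` the connected
components of `{x ∈ supp(f) : f(x) ≥ r}`. -/
def densityContour {d : ℕ} (f : E d → ℝ) : HierarchicalClustering (tsupport f) where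
  toFun r :=
    { clusters := {C | ∃ x ∈ {z : tsupport f | (OrderDual.ofDual r).1 ≤ f z},
        C = connectedComponentIn {z : tsupport f | (OrderDual.ofDual r).1 ≤ f z} x}
      nonempty := by
        rintro _ ⟨x, hx, rfl⟩
        exact ⟨x, mem_connectedComponentIn hx⟩
      disjoint := by
        rintro _ ⟨x, hx, rfl⟩ _ ⟨y, hy, rfl⟩ hne
        refine Set.disjoint_left.2 fun z hzx hzy => hne ?_
        rw [connectedComponentIn_eq hzx, connectedComponentIn_eq hzy] }
  monotone' := by
    rintro r r' h _ ⟨x, hx, rfl⟩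
    have hle : (OrderDual.ofDual r').1 ≤ (OrderDual.ofDual r).1 := h
    exact ⟨_, ⟨x, hle.trans hx, rfl⟩,
      connectedComponentIn_mono x fun z hz => hle.trans hz⟩

/-- The algorithm `𝔸` is MI-consistent with respect to `f`. The sample is a point `x` of
`supp(f)^n` under the product measure `μ_f^{⊗n}`; `X_n` is the set of its values, with the subspace
metric and the normalized counting measure. That the probability of being
`ε`-measured-interleaved tends to `1` is expressed by the (outer) probability of the complementary
event tending to `0`, so that no measurability of the event is presupposed. -/
def MIConsistent {Θ : Type*} {d : ℕ} (𝔸 : HCAlgorithm Θ) (f : E d → ℝ) : Prop :=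
  ∃ θ : ℕ → Θ, ∀ ε : ℝ, 0 < ε →
    Tendsto (fun n : ℕ =>
      (Measure.pi fun _ : Fin n => densityMeasure f)
        {x : Fin n → tsupport f | ¬ MeasuredInterleavedWrt
          (normalizedCount (Set.range x)) (densityMeasure f)
          (𝔸 (θ n) (Set.range x)) (densityContour f)
          (closestPointCorrespondence (fun p : Set.range x => (p.1 : E d))
            (fun y : tsupport f => (y : E d))) ε ε})
      atTop (𝓝 0)

end GammaLinkage

end

/-!
The reparametrization makes the density threshold of `γ̄` at `r` equal to `r * v_s`, so at level `r`
the linkage thresholds the kernel density estimate of `f` at the value `r`. For a sample whose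
empirical measure is close to `μ_f` on the cells of a fine finite partition of `supp(f)`, this
estimate is within `ε/2` of `f` for all bandwidths in an interval `[s₀, b]`: below `b` the smoothing
error is small because `f` is uniformly continuous, and above `s₀` a slight enlargement or reduction
of the bandwidth absorbs the mesh of the partition, since `K` is monotone. Hence the clustered part
of the sample lies between `{f ≥ r + ε/2}` and `{f ≥ r - ε/2}`.

A cluster of the sample at `r` is connected by steps of length at most `t`, and `f` changes by at
most `ε/2` within that distance, so it lies in a single component of `{f ≥ r - ε}`. Conversely, if
the sample is `ρ`-dense with `3ρ ≤ t`, the sample points near a component of `{f ≥ r}` are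
clustered at `r - ε`, and in a single cluster since the component is connected. The measure
inequalities hold because the empirical measure and `μ_f` are Prokhorov close through the cells of
the partition.

There are no clusters at levels above `max f + ε`, so by monotonicity of the curve only bandwidths
and linkage scales bounded below matter. One partition thus serves all levels for a given `θ`, and
the law of large numbers is needed for its finitely many cells only. A diagonal choice of `θ_n` then
lets `ε` tend to `0`.
-/

namespace GammaLinkage

section Transport

variable {X Y : Type*}

theorem HierarchicalClustering.at'_le_at' (H : HierarchicalClustering X) {r r' : ℝ} (hr : 0 < r)
    (hr' : 0 < r') (h : r ≤ r') : H.at' r' hr' ≤ H.at' r hr :=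
  H.monotone (show OrderDual.toDual (⟨r', hr'⟩ : PosReal) ≤ OrderDual.toDual ⟨r, hr⟩ from h)

theorem Clustering.pullback_le_pullback_iff {Z : Type*} {ψ : Z → X} (hψ : Function.Surjective ψ)
    {φ : Z → Y} {S : Clustering X} {T : Clustering Y} :
    S.pullback ψ ≤ T.pullback φ ↔
      ∀ A ∈ S.clusters, ∃ B ∈ T.clusters, ψ ⁻¹' A ⊆ φ ⁻¹' B := by
  constructor
  · intro h A hA
    obtain ⟨_, ⟨-, B, hB, rfl⟩, hAB⟩ := h _ ⟨(S.nonempty A hA).preimage hψ, A, hA, rfl⟩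
    exact ⟨B, hB, hAB⟩
  · rintro h _ ⟨hne, A, hA, rfl⟩
    obtain ⟨B, hB, hAB⟩ := h A hA
    exact ⟨_, ⟨hne.mono hAB, B, hB, rfl⟩, hAB⟩

theorem Transports.mono {R Q : Set (X × Y)} (hRQ : R ⊆ Q) {A : Set X} {B : Set Y}
    (h : Transports Q A B) : Transports R A B := fun p hp => h p (hRQ hp)

theorem interleavedWrt_iff {H : HierarchicalClustering X} {G : HierarchicalClustering Y}
    {R : Set (X × Y)} {ε : ℝ} :
    InterleavedWrt H G R ε ↔
      IsCorrespondence R ∧ ∀ (r : ℝ) (hr : 0 < r) (hrε : 0 < r - ε),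
        (∀ A ∈ (H.at' r hr).clusters, ∃ B ∈ (G.at' (r - ε) hrε).clusters, Transports R A B) ∧
        ∀ B ∈ (G.at' r hr).clusters, ∃ A ∈ (H.at' (r - ε) hrε).clusters,
          Transports (Prod.swap ⁻¹' R) B A := by
  refine and_congr_right fun hR => forall₃_congr fun r hr hrε => and_congr ?_ ?_
  · have hfst : Function.Surjective fun p : R => p.1.1 := fun x =>
      (hR.1 x).elim fun y hxy => ⟨⟨(x, y), hxy⟩, rfl⟩
    refine (Clustering.pullback_le_pullback_iff hfst).trans ?_
    simp only [Transports, subset_def, mem_preimage, Subtype.forall]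
    exact Iff.rfl
  · have hsnd : Function.Surjective fun p : R => p.1.2 := fun y =>
      (hR.2 y).elim fun x hxy => ⟨⟨(x, y), hxy⟩, rfl⟩
    refine (Clustering.pullback_le_pullback_iff hsnd).trans ?_
    simp only [Transports, subset_def, mem_preimage, Subtype.forall]
    exact forall₂_congr fun B _ => exists_congr fun A => and_congr_right fun _ =>
      ⟨fun h p hp => h p.swap hp, fun h p hp => h p.swap hp⟩

variable [MeasurableSpace X] [MeasurableSpace Y]

/-- One half of a measured interleaving at a single scale: every cluster of `S` is transported into
a cluster of `T`, and finite unions of clusters lose mass at most `m`. -/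
structure MeasuredTransports (μ : Measure X) (ν : Measure Y) (R : Set (X × Y))
    (S : Clustering X) (T : Clustering Y) (m : ℝ) : Prop where
  exists_transports : ∀ A ∈ S.clusters, ∃ B ∈ T.clusters, Transports R A B
  measure_iUnion_le : ∀ (N : ℕ) (A : Fin N → Set X) (B : Fin N → Set Y),
    (∀ i, A i ∈ S.clusters) → (∀ i, B i ∈ T.clusters) → (∀ i, Transports R (A i) (B i)) →
    μ (⋃ i, A i) ≤ ν (⋃ i, B i) + ENNReal.ofReal m

/-- Every set `A` satisfies `μ A ≤ ν Q(A) + m`, where `Q(A)` is the image of `A` under the relation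
`Q`. If `Q` relates the points at distance at most `ρ`, this is one half of the assertion that `μ`
and `ν` are close in the Prokhorov distance. -/
def ProkhorovLE (μ : Measure X) (ν : Measure Y) (Q : Set (X × Y)) (m : ℝ) : Prop :=
  ∀ A : Set X, μ A ≤ ν (SetRel.image Q A) + ENNReal.ofReal m

variable {μ : Measure X} {ν : Measure Y} {R Q : Set (X × Y)} {S : Clustering X}
  {T T' : Clustering Y} {m m' : ℝ}

theorem ProkhorovLE.mono {Q' : Set (X × Y)} (h : ProkhorovLE μ ν Q m) (hQ : Q ⊆ Q') (hm : m ≤ m') :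
    ProkhorovLE μ ν Q' m' := fun A =>
  (h A).trans (add_le_add (measure_mono (SetRel.image_subset_image_left hQ))
    (ENNReal.ofReal_le_ofReal hm))

theorem ProkhorovLE.exists_mem (h : ProkhorovLE μ ν Q m) {A : Set X}
    (hA : ENNReal.ofReal m < μ A) : ∃ x ∈ A, ∃ y, (x, y) ∈ Q := by
  by_contra! hempty
  have himage : SetRel.image Q A = ∅ :=
    eq_empty_of_forall_notMem fun y ⟨x, hx, hxy⟩ => hempty x hx y hxy
  have hle := h A
  rw [himage, measure_empty, zero_add] at hle
  exact hle.not_gt hA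

/-- Replacing the target `T` by a coarser clustering only enlarges the transported clusters, as
these are determined by a single point. -/
theorem MeasuredTransports.mono (h : MeasuredTransports μ ν R S T m) (hR : ∀ x, ∃ y, (x, y) ∈ R)
    (hT : T ≤ T') (hm : m ≤ m') : MeasuredTransports μ ν R S T' m' := by
  constructor
  · intro A hA
    obtain ⟨B, hB, hAB⟩ := h.exists_transports A hA
    obtain ⟨C, hC, hBC⟩ := hT B hB
    exact ⟨C, hC, fun p hp hpA => hBC (hAB p hp hpA)⟩
  · intro N A B hA hB hAB
    have hfine : ∀ i, ∃ C ∈ T.clusters, Transports R (A i) C ∧ C ⊆ B i := by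
      intro i
      obtain ⟨C, hC, hAC⟩ := h.exists_transports (A i) (hA i)
      obtain ⟨D, hD, hCD⟩ := hT C hC
      obtain ⟨x, hx⟩ := S.nonempty (A i) (hA i)
      obtain ⟨y, hxy⟩ := hR x
      obtain rfl := T'.eq_of_mem (hB i) hD (hAB i _ hxy hx) (hCD (hAC _ hxy hx))
      exact ⟨C, hC, hAC, hCD⟩
    choose C hC hAC hCB using hfine
    calc μ (⋃ i, A i) ≤ ν (⋃ i, C i) + ENNReal.ofReal m := h.measure_iUnion_le N A C hA hC hAC
      _ ≤ ν (⋃ i, B i) + ENNReal.ofReal m' := by gcongr; exact hCB _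

theorem MeasuredTransports.of_prokhorovLE (hR : ∀ x, ∃ y, (x, y) ∈ R) (hRQ : R ⊆ Q)
    (hQ : ProkhorovLE μ ν Q m)
    (h : ∀ A ∈ S.clusters, ∃ B ∈ T.clusters, Transports Q A B) :
    MeasuredTransports μ ν R S T m := by
  refine ⟨fun A hA => ?_, fun N A B hA hB hAB => ?_⟩
  · obtain ⟨B, hB, hAB⟩ := h A hA
    exact ⟨B, hB, hAB.mono hRQ⟩
  have hQB : ∀ i, Transports Q (A i) (B i) := by
    intro i
    obtain ⟨C, hC, hAC⟩ := h (A i) (hA i)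
    obtain ⟨x, hx⟩ := S.nonempty (A i) (hA i)
    obtain ⟨y, hxy⟩ := hR x
    rwa [T.eq_of_mem (hB i) hC (hAB i _ hxy hx) (hAC _ (hRQ hxy) hx)]
  have himage : SetRel.image Q (⋃ i, A i) ⊆ ⋃ i, B i := by
    rintro y ⟨x, hx, hxy⟩
    obtain ⟨i, hi⟩ := mem_iUnion.1 hx
    exact mem_iUnion.2 ⟨i, hQB i _ hxy hi⟩
  exact (hQ _).trans (add_le_add_left (measure_mono himage) _)

theorem measuredInterleavedWrt_iff {H : HierarchicalClustering X} {G : HierarchicalClustering Y}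
    {ε : ℝ} :
    MeasuredInterleavedWrt μ ν H G R ε m ↔
      H.IsMeasurable ∧ G.IsMeasurable ∧ IsCorrespondence R ∧
        ∀ (r : ℝ) (hr : 0 < r) (hrε : 0 < r - ε),
          MeasuredTransports μ ν R (H.at' r hr) (G.at' (r - ε) hrε) m ∧
          MeasuredTransports ν μ (Prod.swap ⁻¹' R) (G.at' r hr) (H.at' (r - ε) hrε) m := by
  rw [MeasuredInterleavedWrt, interleavedWrt_iff]
  constructor
  · rintro ⟨hH, hG, ⟨hR, hI⟩, hm⟩
    exact ⟨hH, hG, hR, fun r hr hrε =>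
      ⟨⟨(hI r hr hrε).1, fun N => (hm r hr hrε N).1⟩,
        ⟨(hI r hr hrε).2, fun N => (hm r hr hrε N).2⟩⟩⟩
  · rintro ⟨hH, hG, hR, h⟩
    exact ⟨hH, hG, ⟨hR, fun r hr hrε =>
        ⟨(h r hr hrε).1.exists_transports, (h r hr hrε).2.exists_transports⟩⟩,
      fun r hr hrε N =>
        ⟨(h r hr hrε).1.measure_iUnion_le N, (h r hr hrε).2.measure_iUnion_le N⟩⟩

theorem MeasuredInterleavedWrt.mono {H : HierarchicalClustering X} {G : HierarchicalClustering Y}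
    {ε ε' : ℝ} (h : MeasuredInterleavedWrt μ ν H G R ε m) (hε : ε ≤ ε') (hm : m ≤ m') :
    MeasuredInterleavedWrt μ ν H G R ε' m' := by
  obtain ⟨hH, hG, hR, h⟩ := measuredInterleavedWrt_iff.1 h
  refine measuredInterleavedWrt_iff.2 ⟨hH, hG, hR, fun r hr hrε' => ?_⟩
  have hrε : 0 < r - ε := by linarith
  obtain ⟨hHG, hGH⟩ := h r hr hrε
  exact ⟨hHG.mono hR.1 (G.at'_le_at' hrε' hrε (by linarith)) hm,
    hGH.mono hR.2 (H.at'_le_at' hrε' hrε (by linarith)) hm⟩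

end Transport

namespace Clustering

section Coarse

variable {X : Type*} [PseudoMetricSpace X]

/-- Distinct clusters of `S` are more than `t` apart. -/
def IsSeparated (S : Clustering X) (t : ℝ) : Prop :=
  ∀ A ∈ S.clusters, ∀ B ∈ S.clusters, ∀ p ∈ A, ∀ q ∈ B, dist p q ≤ t → A = B

/-- Any two points of a cluster of `S` are joined, inside the cluster, by a chain with steps of
length at most `t`; this is encoded as an induction principle along such chains. -/
def IsChained (S : Clustering X) (t : ℝ) : Prop :=
  ∀ A ∈ S.clusters, ∀ P : Set X, (A ∩ P).Nonempty →
    (∀ p ∈ A, ∀ q ∈ A, dist p q ≤ t → p ∈ P → q ∈ P) → A ⊆ P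

theorem IsSeparated.mono {S : Clustering X} {t t' : ℝ} (h : S.IsSeparated t) (ht : t' ≤ t) :
    S.IsSeparated t' :=
  fun A hA B hB p hp q hq hpq => h A hA B hB p hp q hq (hpq.trans ht)

theorem IsChained.mono {S : Clustering X} {t t' : ℝ} (h : S.IsChained t) (ht : t ≤ t') :
    S.IsChained t' :=
  fun A hA P hP hstep => h A hA P hP fun p hp q hq hpq => hstep p hp q hq (hpq.trans ht)

end Coarse

section Linkage

variable {X : Type*} [MetricSpace X]

/-- The single-linkage clustering at scale `t` of the subspace `U`, as a clustering of `X`. -/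
def linkage (U : Set X) (t : PosReal) : Clustering X :=
  ofSubset U (singleLinkage U t)

variable (U : Set X) (t : PosReal)

theorem sUnion_linkage : ⋃₀ (linkage U t).clusters = U := by
  refine Subset.antisymm ?_ fun p hp => ?_
  · rintro _ ⟨_, ⟨A, -, rfl⟩, x, -, rfl⟩
    exact x.2
  · exact ⟨_, ⟨_, ⟨⟨p, hp⟩, rfl⟩, rfl⟩, ⟨⟨p, hp⟩, .refl _, rfl⟩⟩

theorem isSeparated_linkage : (linkage U t).IsSeparated t.1 := by
  rintro _ ⟨_, ⟨y, rfl⟩, rfl⟩ B hB _ ⟨p, hp, rfl⟩ q hq hpq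
  have hqU : q ∈ U := (sUnion_linkage U t).subset ⟨B, hB, hq⟩
  refine eq_of_mem (linkage U t) ⟨_, ⟨y, rfl⟩, rfl⟩ hB ⟨⟨q, hqU⟩, ?_, rfl⟩ hq
  exact .trans _ _ _ (.symm _ _ (.rel p ⟨q, hqU⟩ hpq)) hp

theorem isChained_linkage : (linkage U t).IsChained t.1 := by
  rintro _ ⟨_, ⟨y, rfl⟩, rfl⟩ P ⟨_, ⟨p, hp, rfl⟩, hpP⟩ hstep
  have hclass : ∀ a b : U, Relation.EqvGen (fun a b : U => dist a b ≤ t.1) a b →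
      Relation.EqvGen (fun a b : U => dist a b ≤ t.1) a y → (a.1 ∈ P ↔ b.1 ∈ P) := by
    intro a b hab
    induction hab with
    | rel a b hab =>
      intro ha
      have hb : Relation.EqvGen (fun a b : U => dist a b ≤ t.1) b y :=
        .trans _ _ _ (.symm _ _ (.rel a b hab)) ha
      exact ⟨hstep a ⟨a, ha, rfl⟩ b ⟨b, hb, rfl⟩ hab,
        hstep b ⟨b, hb, rfl⟩ a ⟨a, ha, rfl⟩ (by rwa [dist_comm])⟩
    | refl a => exact fun _ => Iff.rfl
    | symm a b hab ih => exact fun hb => (ih (.trans _ _ _ hab hb)).symm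
    | trans a b c hab _ ih₁ ih₂ =>
      exact fun ha => (ih₁ ha).trans (ih₂ (.trans _ _ _ (.symm _ _ hab) ha))
  rintro _ ⟨z, hz, rfl⟩
  exact (hclass z p (.trans _ _ _ hz (.symm _ _ hp)) hz).2 hpP

end Linkage

section Subspace

variable {Y : Type*} [PseudoMetricSpace Y] {X : Set Y} {ρ : ℝ}

/-- The clusters of `T` containing the balls around two consecutive points of a chain overlap, hence
they agree. -/
theorem IsChained.exists_transports {S : Clustering X} {T : Clustering Y} {b : ℝ}
    (hS : S.IsChained b) (hb : 0 ≤ b) {A : Set X} (hA : A ∈ S.clusters)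
    (h : ∀ p ∈ A, ∃ C ∈ T.clusters, Metric.closedBall p.1 b ⊆ C) :
    ∃ C ∈ T.clusters, Transports {p : X × Y | dist p.1.1 p.2 ≤ b} A C := by
  obtain ⟨p₀, hp₀⟩ := S.nonempty A hA
  obtain ⟨C, hC, hp₀C⟩ := h p₀ hp₀
  have hAC : A ⊆ {p | Metric.closedBall p.1 b ⊆ C} := by
    refine hS A hA _ ⟨p₀, hp₀, hp₀C⟩ fun p _ q hq hpq hpC => ?_
    obtain ⟨D, hD, hqD⟩ := h q hq
    have hqC : q.1 ∈ C := hpC (Metric.mem_closedBall'.2 hpq)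
    obtain rfl := T.eq_of_mem hC hD hqC (hqD (Metric.mem_closedBall_self hb))
    exact hqD
  exact ⟨C, hC, fun p hp hpA => hAC hpA (Metric.mem_closedBall'.2 hp)⟩

theorem IsSeparated.exists_cluster_of_near {T : Clustering X} (hT : T.IsSeparated (3 * ρ))
    {y z : Y} (hyz : dist y z ≤ ρ) (hy : ∃ p : X, dist p.1 y ≤ ρ)
    (hcover : ∀ p : X, dist p.1 y ≤ ρ ∨ dist p.1 z ≤ ρ → p ∈ ⋃₀ T.clusters) :
    ∃ A ∈ T.clusters, ∀ p : X, dist p.1 y ≤ ρ ∨ dist p.1 z ≤ ρ → p ∈ A := by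
  obtain ⟨p, hp⟩ := hy
  obtain ⟨A, hA, hpA⟩ := hcover p (.inl hp)
  refine ⟨A, hA, fun q hq => ?_⟩
  obtain ⟨D, hD, hqD⟩ := hcover q hq
  have hqy : dist q.1 y ≤ 2 * ρ := by
    rcases hq with hq | hq
    · linarith [dist_nonneg (x := q.1) (y := y)]
    · linarith [dist_triangle_right q.1 y z]
  have hpq : dist p q ≤ 3 * ρ := by
    rw [Subtype.dist_eq]
    linarith [dist_triangle_right p.1 q.1 y]
  rwa [hT A hA D hD p hpA q hqD hpq]

/-- The points of `X` near `y ∈ B` lie in a single cluster of `T`, which is locally constant in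
`y`. -/
theorem IsSeparated.exists_transports {T : Clustering X} (hT : T.IsSeparated (3 * ρ))
    (hρ : 0 < ρ) {B : Set Y} (hB : IsPreconnected B) (hne : B.Nonempty)
    (hdense : ∀ y ∈ B, ∃ p : X, dist p.1 y ≤ ρ)
    (hcover : ∀ y ∈ B, ∀ p : X, dist p.1 y ≤ ρ → p ∈ ⋃₀ T.clusters) :
    ∃ A ∈ T.clusters, Transports (Prod.swap ⁻¹' {p : X × Y | dist p.1.1 p.2 ≤ ρ}) B A := by
  have hnear : ∀ y ∈ B, ∀ z ∈ B, dist y z ≤ ρ →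
      ∃ A ∈ T.clusters, ∀ p : X, dist p.1 y ≤ ρ ∨ dist p.1 z ≤ ρ → p ∈ A :=
    fun y hy z hz hyz => hT.exists_cluster_of_near hyz (hdense y hy) fun p hp =>
      hp.elim (hcover y hy p) (hcover z hz p)
  have hjoin : ∀ y ∈ B, ∀ z ∈ B,
      ∃ A ∈ T.clusters, ∀ p : X, dist p.1 y ≤ ρ ∨ dist p.1 z ≤ ρ → p ∈ A := by
    intro y hy z hz
    refine hB.induction₂' (fun y z =>
      ∃ A ∈ T.clusters, ∀ p : X, dist p.1 y ≤ ρ ∨ dist p.1 z ≤ ρ → p ∈ A) ?_ ?_ hy hz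
    · intro y hy
      filter_upwards [self_mem_nhdsWithin,
        mem_nhdsWithin_of_mem_nhds (Metric.closedBall_mem_nhds y hρ)] with z hz hzy
      exact ⟨hnear y hy z hz (by rw [dist_comm]; exact hzy), hnear z hz y hy hzy⟩
    · rintro x y z - hy - ⟨A, hA, hxy⟩ ⟨D, hD, hyz⟩
      obtain ⟨q, hq⟩ := hdense y hy
      obtain rfl := T.eq_of_mem hA hD (hxy q (.inr hq)) (hyz q (.inl hq))
      exact ⟨A, hA, fun p hp => hp.elim (hxy p ∘ .inl) (hyz p ∘ .inr)⟩
  obtain ⟨y₀, hy₀⟩ := hne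
  obtain ⟨p₀, hp₀⟩ := hdense y₀ hy₀
  obtain ⟨A, hA, hp₀A⟩ := hcover y₀ hy₀ p₀ hp₀
  refine ⟨A, hA, fun q hq hqB => ?_⟩
  obtain ⟨D, hD, hqD⟩ := hjoin y₀ hy₀ q.1 hqB
  rw [T.eq_of_mem hA hD hp₀A (hqD p₀ (.inl hp₀))]
  exact hqD q.2 (.inr hq)

end Subspace

end Clustering

section Contour

variable {d : ℕ} {f : E d → ℝ} {r : ℝ} {hr : 0 < r}

theorem sUnion_densityContour :
    ⋃₀ ((densityContour f).at' r hr).clusters = {y : tsupport f | r ≤ f y} := by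
  refine Subset.antisymm ?_ fun y hy => ?_
  · rintro y ⟨_, ⟨z, -, rfl⟩, hy⟩
    exact connectedComponentIn_subset {z : tsupport f | r ≤ f z} z hy
  · exact ⟨_, ⟨y, hy, rfl⟩, mem_connectedComponentIn (F := {z : tsupport f | r ≤ f z}) hy⟩

theorem isPreconnected_of_mem_densityContour {B : Set (tsupport f)}
    (hB : B ∈ ((densityContour f).at' r hr).clusters) : IsPreconnected B := by
  obtain ⟨z, -, rfl⟩ := hB
  exact isPreconnected_connectedComponentIn

theorem isMeasurable_densityContour (hf : Continuous f) : (densityContour f).IsMeasurable := by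
  rintro r hr _ ⟨z, hz, rfl⟩
  have hclosed : IsClosed {z : tsupport f | r ≤ f z} :=
    isClosed_le continuous_const (hf.comp continuous_subtype_val)
  have hclosure : closure (connectedComponentIn {z : tsupport f | r ≤ f z} z) ⊆
      connectedComponentIn {z : tsupport f | r ≤ f z} z :=
    isPreconnected_connectedComponentIn.closure.subset_connectedComponentIn
      (subset_closure (mem_connectedComponentIn hz))
      (closure_minimal (connectedComponentIn_subset _ _) hclosed)
  exact (isClosed_of_closure_subset hclosure).measurableSet

theorem mem_densityContour_of_segment {B : Set (tsupport f)}
    (hB : B ∈ ((densityContour f).at' r hr).clusters) {x y : tsupport f} (hx : x ∈ B)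
    (h : ∀ z ∈ segment ℝ (x : E d) y, r ≤ f z) : y ∈ B := by
  obtain ⟨z, -, rfl⟩ := hB
  rw [connectedComponentIn_eq hx]
  have hsupp : segment ℝ (x : E d) y ⊆ tsupport f := fun z hz =>
    subset_tsupport f (Function.mem_support.2 (hr.trans_le (h z hz)).ne')
  have hpre : IsPreconnected ((Subtype.val : tsupport f → E d) ⁻¹' segment ℝ (x : E d) y) := by
    rw [← Topology.IsInducing.subtypeVal.isPreconnected_image, Subtype.image_preimage_coe,
      inter_eq_right.2 hsupp]
    exact (convex_segment _ _).isPreconnected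
  exact hpre.subset_connectedComponentIn (left_mem_segment ℝ _ _) (fun w hw => h w hw)
    (right_mem_segment ℝ (x : E d) y)

theorem exists_closedBall_subset_densityContour {b δ : ℝ}
    (hmod : ∀ y z : E d, dist y z ≤ b → |f y - f z| ≤ δ) (hδ : 0 ≤ δ) {y : tsupport f}
    (hy : r + δ ≤ f y) :
    ∃ B ∈ ((densityContour f).at' r hr).clusters, Metric.closedBall y b ⊆ B := by
  obtain ⟨B, hB, hyB⟩ : y ∈ ⋃₀ ((densityContour f).at' r hr).clusters := by
    rw [sUnion_densityContour, mem_ofPred_eq]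
    linarith
  refine ⟨B, hB, fun z hz => mem_densityContour_of_segment hB hyB fun w hw => ?_⟩
  have hyz : dist (y : E d) z ≤ b := Metric.mem_closedBall'.1 hz
  have hyw : dist (y : E d) w ≤ b := by
    linarith [dist_add_dist_of_mem_segment hw, dist_nonneg (x := w) (y := (z : E d))]
  linarith [(abs_le.1 (hmod y w hyw)).2]

end Contour

section ClosestPoint

variable {Y Z : Type*} [MetricSpace Z] {X : Set Y}

theorem closestPointCorrespondence_subset [MetricSpace Y] {j : Y → Z} (hj : Isometry j) {ρ : ℝ}
    (hρ : 0 ≤ ρ) (hdense : ∀ y, ∃ p : X, dist p.1 y ≤ ρ) :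
    closestPointCorrespondence (fun p : X => j p) j ⊆ {p | dist p.1.1 p.2 ≤ ρ} := by
  rintro ⟨x, y⟩ (h | h)
  · simpa only [mem_ofPred_eq, hj.dist_eq, dist_self] using (h x).trans (by simpa using hρ)
  · obtain ⟨p, hp⟩ := hdense y
    simpa only [mem_ofPred_eq, hj.dist_eq] using (h p).trans ((hj.dist_eq _ _).trans_le hp)

theorem isCorrespondence_closestPointCorrespondence [Finite X] [Nonempty X] (j : Y → Z) :
    IsCorrespondence (closestPointCorrespondence (fun p : X => j p) j) := by
  refine ⟨fun x => ⟨x, .inl fun y => ?_⟩, fun y => ?_⟩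
  · simpa only [dist_self] using dist_nonneg
  · obtain ⟨x, hx⟩ := Finite.exists_min fun x : X => dist (j x) (j y)
    exact ⟨x, .inr hx⟩

end ClosestPoint

section Interleaving

variable {d : ℕ} {f : E d → ℝ} {X : Set (tsupport f)}

/-- The clustering `S` of a subset of `supp(f)` approximates the density contour of `f` at level
`r`: its clusters cover the points at level `r + δ`, consist of points at level `r - δ`, are chained
at scale `b`, and are separated by more than `τ`. -/
structure ApproximatesContour (f : E d → ℝ) {X : Set (tsupport f)} (S : Clustering X)
    (r δ b τ : ℝ) : Prop where
  le_of_mem : ∀ p ∈ ⋃₀ S.clusters, r - δ ≤ f p.1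
  mem_of_le : ∀ p : X, r + δ ≤ f p.1 → p ∈ ⋃₀ S.clusters
  isChained : S.IsChained b
  isSeparated : S.IsSeparated τ

variable {M ε δ b ρ : ℝ} {H : HierarchicalClustering X}

theorem exists_transports_densityContour (hδ : 0 < δ) (hδε : 2 * δ ≤ ε) (hM0 : 0 ≤ M)
    (hM : ∀ y, f y ≤ M) (hb : 0 ≤ b) (hρb : ρ ≤ b)
    (hmod : ∀ y z : E d, dist y z ≤ b → |f y - f z| ≤ δ)
    (hH : ∀ r (hr : 0 < r), r ≤ M + ε → ApproximatesContour f (H.at' r hr) r δ b (3 * ρ))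
    {r : ℝ} (hr : 0 < r) (hrε : 0 < r - ε) {A : Set X} (hA : A ∈ (H.at' r hr).clusters) :
    ∃ B ∈ ((densityContour f).at' (r - ε) hrε).clusters,
      Transports {p : X × tsupport f | dist p.1.1 p.2 ≤ ρ} A B := by
  have hrM : r ≤ M + ε := by
    by_contra! hrM
    have hMε : 0 < M + ε := by linarith
    obtain ⟨A', hA', hAA'⟩ := H.at'_le_at' hMε hr hrM.le A hA
    obtain ⟨p, hp⟩ := (H.at' r hr).nonempty A hA
    linarith [(hH _ hMε le_rfl).le_of_mem p ⟨A', hA', hAA' hp⟩, hM p.1]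
  have happrox := hH r hr hrM
  obtain ⟨B, hB, hAB⟩ := happrox.isChained.exists_transports hb hA fun p hp =>
    exists_closedBall_subset_densityContour (hr := hrε) hmod hδ.le
      (by linarith [happrox.le_of_mem p ⟨A, hA, hp⟩])
  exact ⟨B, hB, hAB.mono fun p hp => le_trans hp hρb⟩

theorem exists_transports_of_mem_densityContour (hδε : 2 * δ ≤ ε) (hM : ∀ y, f y ≤ M)
    (hρ : 0 < ρ) (hρb : ρ ≤ b) (hmod : ∀ y z : E d, dist y z ≤ b → |f y - f z| ≤ δ)
    (hH : ∀ r (hr : 0 < r), r ≤ M + ε → ApproximatesContour f (H.at' r hr) r δ b (3 * ρ))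
    (hdense : ∀ y, ∃ p : X, dist p.1 y ≤ ρ) {r : ℝ} (hr : 0 < r) (hrε : 0 < r - ε)
    {B : Set (tsupport f)} (hB : B ∈ ((densityContour f).at' r hr).clusters) :
    ∃ A ∈ (H.at' (r - ε) hrε).clusters,
      Transports (Prod.swap ⁻¹' {p : X × tsupport f | dist p.1.1 p.2 ≤ ρ}) B A := by
  have hrf : ∀ y ∈ B, r ≤ f y := fun y hy => sUnion_densityContour.subset ⟨B, hB, hy⟩
  have hne : B.Nonempty := ((densityContour f).at' r hr).nonempty B hB
  have hrM : r - ε ≤ M + ε := by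
    obtain ⟨y, hy⟩ := hne
    have hδ : 0 ≤ δ := (abs_nonneg _).trans (hmod y y (by simpa using hρ.le.trans hρb))
    linarith [hrf y hy, hM y]
  have happrox := hH _ hrε hrM
  refine happrox.isSeparated.exists_transports hρ (isPreconnected_of_mem_densityContour hB) hne
    (fun y _ => hdense y) fun y hy p hp => happrox.mem_of_le p ?_
  linarith [(abs_le.1 (hmod p.1 y (hp.trans hρb))).1, hrf y hy]

theorem measuredInterleavedWrt_densityContour [Finite X] [Nonempty X] (hcont : Continuous f)
    {μ : Measure X} {ν : Measure (tsupport f)} (hδ : 0 < δ) (hδε : 2 * δ ≤ ε) (hM0 : 0 ≤ M)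
    (hM : ∀ y, f y ≤ M) (hρ : 0 < ρ) (hρb : ρ ≤ b)
    (hmod : ∀ y z : E d, dist y z ≤ b → |f y - f z| ≤ δ)
    (hH : ∀ r (hr : 0 < r), r ≤ M + ε → ApproximatesContour f (H.at' r hr) r δ b (3 * ρ))
    (hdense : ∀ y, ∃ p : X, dist p.1 y ≤ ρ)
    (hμν : ProkhorovLE μ ν {p : X × tsupport f | dist p.1.1 p.2 ≤ ρ} ε)
    (hνμ : ProkhorovLE ν μ (Prod.swap ⁻¹' {p : X × tsupport f | dist p.1.1 p.2 ≤ ρ}) ε) :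
    MeasuredInterleavedWrt μ ν H (densityContour f)
      (closestPointCorrespondence (fun p : X => (p.1 : E d)) (fun y : tsupport f => (y : E d)))
      ε ε := by
  have hcorr := isCorrespondence_closestPointCorrespondence (X := X)
    fun y : tsupport f => (y : E d)
  have hsubset := closestPointCorrespondence_subset isometry_subtype_coe hρ.le hdense
  refine measuredInterleavedWrt_iff.2 ⟨fun r hr A _ => A.toFinite.measurableSet,
    isMeasurable_densityContour hcont, hcorr, fun r hr hrε => ⟨?_, ?_⟩⟩
  · exact .of_prokhorovLE hcorr.1 hsubset hμν fun A hA =>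
      exists_transports_densityContour hδ hδε hM0 hM (hρ.le.trans hρb) hρb hmod hH hr hrε hA
  · exact .of_prokhorovLE hcorr.2 (preimage_mono hsubset) hνμ fun B hB =>
      exists_transports_of_mem_densityContour hδε hM hρ hρb hmod hH hdense hr hrε hB

end Interleaving

section SampleMean

open ProbabilityTheory

variable {X Z : Type*} {n : ℕ}

/-- The mean of `g` over the sample `x`; it is `0` for the empty sample. -/
noncomputable def sampleMean (x : Fin n → X) (g : X → ℝ) : ℝ := (∑ i, g (x i)) / n

theorem sampleMean_mono {x : Fin n → X} {g h : X → ℝ} (hgh : ∀ y, g y ≤ h y) :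
    sampleMean x g ≤ sampleMean x h :=
  div_le_div_of_nonneg_right (Finset.sum_le_sum fun i _ => hgh (x i)) n.cast_nonneg

theorem sampleMean_const_mul (x : Fin n → X) (c : ℝ) (g : X → ℝ) :
    sampleMean x (fun y => c * g y) = c * sampleMean x g := by
  simp only [sampleMean, ← Finset.mul_sum, mul_div_assoc]

theorem sampleMean_const_sub (hn : 0 < n) (x : Fin n → X) (c : ℝ) (g : X → ℝ) :
    sampleMean x (fun y => c - g y) = c - sampleMean x g := by
  have hn' : (n : ℝ) ≠ 0 := by positivity
  simp [sampleMean, sub_div, hn']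

theorem sampleMean_sum {ι : Type*} (s : Finset ι) (x : Fin n → X) (g : ι → X → ℝ) :
    sampleMean x (fun y => ∑ c ∈ s, g c y) = ∑ c ∈ s, sampleMean x (g c) := by
  simp only [sampleMean, Finset.sum_comm (s := Finset.univ), Finset.sum_div]

variable [MeasurableSpace X] {μ : Measure X}

section Chebyshev

variable [IsProbabilityMeasure μ]

theorem integral_sum_pi {g : X → ℝ} (hg : Integrable g μ) (n : ℕ) :
    ∫ x, ∑ i, g (x i) ∂(Measure.pi fun _ : Fin n => μ) = n * ∫ y, g y ∂μ := by
  have hint : ∀ i, Integrable (fun x : Fin n → X => g (x i)) (Measure.pi fun _ => μ) := fun i =>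
    integrable_comp_eval hg
  simp [integral_finsetSum _ fun i _ => hint i,
    integral_comp_eval (μ := fun _ : Fin n => μ) hg.aestronglyMeasurable]

theorem pi_le_abs_sampleMean_sub_integral {g : X → ℝ} (hg : MemLp g 2 μ) {η : ℝ} (hη : 0 < η)
    (hn : 0 < n) :
    (Measure.pi fun _ : Fin n => μ) {x | η ≤ |sampleMean x g - ∫ y, g y ∂μ|} ≤
      ENNReal.ofReal (variance g μ / (n * η ^ 2)) := by
  have hn' : (0 : ℝ) < n := by exact_mod_cast hn
  have hmem : ∀ i : Fin n, MemLp (fun x : Fin n → X => g (x i)) 2 (Measure.pi fun _ => μ) :=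
    fun i => hg.comp_measurePreserving (measurePreserving_eval (fun _ => μ) i)
  have hvar := variance_sum_pi (μ := fun _ : Fin n => μ) (X := fun _ => g) fun _ => hg
  have hcheb := meas_ge_le_variance_div_sq (memLp_finsetSum' Finset.univ fun i _ => hmem i)
    (mul_pos hn' hη)
  simp only [Finset.sum_const, Finset.card_univ, Fintype.card_fin, nsmul_eq_mul] at hvar
  simp only [hvar, Finset.sum_apply, integral_sum_pi (hg.integrable one_le_two) n] at hcheb
  have hscale : variance g μ / (n * η ^ 2) = n * variance g μ / (n * η) ^ 2 := by field_simp
  rw [hscale]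
  refine (measure_mono fun x hx => ?_).trans hcheb
  have hmean : ∑ i, g (x i) - n * ∫ y, g y ∂μ = n * (sampleMean x g - ∫ y, g y ∂μ) := by
    rw [sampleMean]
    field_simp
  rw [mem_ofPred_eq, hmean, abs_mul, abs_of_pos hn']
  exact mul_le_mul_of_nonneg_left hx hn'.le

theorem tendsto_pi_le_abs_sampleMean_sub_integral {g : X → ℝ} (hg : MemLp g 2 μ) {η : ℝ}
    (hη : 0 < η) :
    Tendsto (fun n : ℕ => (Measure.pi fun _ : Fin n => μ)
      {x | η ≤ |sampleMean x g - ∫ y, g y ∂μ|}) atTop (𝓝 0) := by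
  have hbound : Tendsto (fun n : ℕ => ENNReal.ofReal (variance g μ / (n * η ^ 2))) atTop
      (𝓝 0) := by
    rw [← ENNReal.ofReal_zero]
    exact ENNReal.tendsto_ofReal (tendsto_const_nhds.div_atTop
      (tendsto_natCast_atTop_atTop.atTop_mul_const (by positivity)))
  refine tendsto_of_tendsto_of_tendsto_of_le_of_le' tendsto_const_nhds hbound
    (Eventually.of_forall fun _ => zero_le) ?_
  filter_upwards [eventually_gt_atTop 0] with n hn using
    pi_le_abs_sampleMean_sub_integral hg hη hn

end Chebyshev

/-- The sample `x` represents `μ` up to `κ` at the resolution of the finite-valued map `q`: the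
sample mean and the `μ`-mean differ by at most `κ` simultaneously for all `[0, 1]`-valued functions
that factor through `q`. -/
def IsRepresentative (μ : Measure X) (q : SimpleFunc X Z) (κ : ℝ) (x : Fin n → X) : Prop :=
  ∀ g : Z → ℝ, (∀ z, 0 ≤ g z) → (∀ z, g z ≤ 1) →
    |sampleMean x (fun y => g (q y)) - ∫ y, g (q y) ∂μ| ≤ κ

theorem IsRepresentative.mono {q : SimpleFunc X Z} {κ κ' : ℝ} {x : Fin n → X}
    (h : IsRepresentative μ q κ x) (hκ : κ ≤ κ') : IsRepresentative μ q κ' x :=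
  fun g hg0 hg1 => (h g hg0 hg1).trans hκ

theorem IsRepresentative.of_fibers [IsFiniteMeasure μ] {q : SimpleFunc X Z} {κ : ℝ} {x : Fin n → X}
    (h : ∀ z ∈ q.range, |sampleMean x ((q ⁻¹' {z}).indicator 1) -
      ∫ y, (q ⁻¹' {z}).indicator 1 y ∂μ| ≤ κ) :
    IsRepresentative μ q (q.range.card * κ) x := by
  classical
  intro g hg0 hg1
  have hg : ∀ y, g (q y) = ∑ z ∈ q.range, g z * (q ⁻¹' {z}).indicator 1 y := fun y => by
    simp [indicator_apply]
  have hint : ∀ z, Integrable (fun y => g z * (q ⁻¹' {z}).indicator 1 y) μ := fun z =>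
    ((integrable_const 1).indicator (q.measurableSet_fiber z)).const_mul _
  simp_rw [hg]
  rw [sampleMean_sum, integral_finsetSum _ fun z _ => hint z, ← Finset.sum_sub_distrib]
  calc |∑ z ∈ q.range, (sampleMean x (fun y => g z * (q ⁻¹' {z}).indicator 1 y) -
        ∫ y, g z * (q ⁻¹' {z}).indicator 1 y ∂μ)|
      ≤ ∑ z ∈ q.range, |sampleMean x (fun y => g z * (q ⁻¹' {z}).indicator 1 y) -
        ∫ y, g z * (q ⁻¹' {z}).indicator 1 y ∂μ| := Finset.abs_sum_le_sum_abs _ _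
    _ ≤ ∑ _z ∈ q.range, κ := by
        refine Finset.sum_le_sum fun z hz => ?_
        rw [sampleMean_const_mul, integral_const_mul, ← mul_sub, abs_mul, abs_of_nonneg (hg0 z)]
        exact (mul_le_of_le_one_left (abs_nonneg _) (hg1 z)).trans (h z hz)
    _ = q.range.card * κ := by simp

theorem tendsto_pi_not_isRepresentative [IsProbabilityMeasure μ] (q : SimpleFunc X Z) {κ : ℝ}
    (hκ : 0 < κ) :
    Tendsto (fun n : ℕ => (Measure.pi fun _ : Fin n => μ) {x | ¬ IsRepresentative μ q κ x}) atTop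
      (𝓝 0) := by
  set η : ℝ := κ / (q.range.card + 1)
  have hη : 0 < η := by positivity
  have hcard : q.range.card * η ≤ κ := by
    rw [mul_div_assoc', div_le_iff₀ (by positivity)]
    nlinarith
  have hfibers : Tendsto (fun n : ℕ => ∑ z ∈ q.range, (Measure.pi fun _ : Fin n => μ)
      {x | η ≤ |sampleMean x ((q ⁻¹' {z}).indicator 1) - ∫ y, (q ⁻¹' {z}).indicator 1 y ∂μ|})
      atTop (𝓝 0) := by
    rw [← Finset.sum_const_zero (s := q.range)]
    exact tendsto_finsetSum _ fun z _ => tendsto_pi_le_abs_sampleMean_sub_integral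
      (memLp_indicator_const 2 (q.measurableSet_fiber z) 1 (.inr (measure_ne_top _ _))) hη
  refine tendsto_of_tendsto_of_tendsto_of_le_of_le tendsto_const_nhds hfibers
    (fun _ => zero_le) fun n => ?_
  refine (measure_mono fun x hx => ?_).trans (measure_biUnion_finset_le q.range _)
  by_contra hfar
  simp only [mem_iUnion, mem_ofPred_eq, not_exists, not_le] at hfar
  exact hx fun g hg0 hg1 =>
    (IsRepresentative.of_fibers (fun z hz => (hfar z hz).le) g hg0 hg1).trans hcard

theorem pi_eval_eq_eval_eq_zero {ι : Type*} [Fintype ι] [MeasurableEq X] [NullSingletonClass μ]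
    [IsProbabilityMeasure μ] {i j : ι} (hij : i ≠ j) :
    (Measure.pi fun _ : ι => μ) {x | x i = x j} = 0 := by
  have hdiag : (μ.prod μ) (diagonal X) = 0 := by
    rw [Measure.measure_prod_null measurableSet_diagonal]
    refine ae_of_all _ fun y => ?_
    have hslice : Prod.mk y ⁻¹' diagonal X = {y} := by
      ext z
      simp [eq_comm]
    change μ (Prod.mk y ⁻¹' diagonal X) = 0
    rw [hslice, measure_singleton]
  have hindep : IndepFun (fun x : ι → X => x i) (fun x => x j) (Measure.pi fun _ => μ) :=
    (iIndepFun_pi (μ := fun _ : ι => μ) (X := fun _ => id) fun _ => aemeasurable_id).indepFun hij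
  have hmap := (indepFun_iff_map_prod_eq_prod_map_map (measurable_pi_apply i).aemeasurable
    (measurable_pi_apply j).aemeasurable).1 hindep
  rw [(measurePreserving_eval (fun _ : ι => μ) i).map_eq,
    (measurePreserving_eval (fun _ : ι => μ) j).map_eq] at hmap
  rwa [← hmap, Measure.map_apply (by fun_prop) measurableSet_diagonal] at hdiag

theorem pi_not_injective_eq_zero {ι : Type*} [Fintype ι] [MeasurableEq X] [NullSingletonClass μ]
    [IsProbabilityMeasure μ] :
    (Measure.pi fun _ : ι => μ) {x | ¬ Function.Injective x} = 0 := by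
  have hunion : {x : ι → X | ¬ Function.Injective x} ⊆
      ⋃ i, ⋃ j, ⋃ (_ : i ≠ j), {x | x i = x j} := by
    intro x hx
    simp only [Function.Injective, mem_ofPred_eq, not_forall] at hx
    obtain ⟨i, j, hxij, hij⟩ := hx
    simp only [mem_iUnion]
    exact ⟨i, j, hij, hxij⟩
  refine measure_mono_null hunion ?_
  simp only [measure_iUnion_null_iff]
  exact fun i j hij => pi_eval_eq_eval_eq_zero hij

end SampleMean

section RepresentativeSample

variable {X Z : Type*} [MeasurableSpace X] {μ : Measure X} {q : SimpleFunc X Z} {κ C : ℝ} {n : ℕ}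
  {x : Fin n → X}

namespace IsRepresentative

theorem nonneg (h : IsRepresentative μ q κ x) : 0 ≤ κ :=
  (abs_nonneg _).trans (h 0 (fun _ => le_rfl) fun _ => zero_le_one)

theorem sampleMean_le [IsFiniteMeasure μ] (h : IsRepresentative μ q κ x) {g G : X → ℝ} (hC : 0 < C)
    (hg0 : ∀ y, 0 ≤ g y) (hgC : ∀ y, g y ≤ C) (hG : Integrable G μ)
    (hgG : ∀ y z, q z = q y → g z ≤ G y) : sampleMean x g ≤ ∫ y, G y ∂μ + C * κ := by
  set b : Z → ℝ := fun c => (⨆ z : q ⁻¹' {c}, g z) / C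
  have hb0 : ∀ c, 0 ≤ b c := fun c => div_nonneg (Real.iSup_nonneg fun z => hg0 z) hC.le
  have hb1 : ∀ c, b c ≤ 1 := fun c =>
    (div_le_one hC).2 (Real.iSup_le (fun z => hgC z) hC.le)
  have hb : ∀ c, C * b c = ⨆ z : q ⁻¹' {c}, g z := fun c => mul_div_cancel₀ _ hC.ne'
  have hgb : ∀ y, g y ≤ C * b (q y) := fun y => by
    rw [hb]
    exact le_ciSup (f := fun z : q ⁻¹' {q y} => g z)
      ⟨C, forall_mem_range.2 fun z => hgC z⟩ ⟨y, rfl⟩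
  have hbG : ∀ y, C * b (q y) ≤ G y := fun y => by
    have : Nonempty (q ⁻¹' {q y}) := ⟨⟨y, rfl⟩⟩
    rw [hb]
    exact ciSup_le fun z => hgG y z z.2
  have hbint : Integrable (fun y => C * b (q y)) μ :=
    (SimpleFunc.integrable_of_isFiniteMeasure (q.map b)).const_mul C
  calc sampleMean x g ≤ sampleMean x fun y => C * b (q y) := sampleMean_mono hgb
    _ = C * sampleMean x fun y => b (q y) := sampleMean_const_mul x C _
    _ ≤ C * (∫ y, b (q y) ∂μ + κ) :=
        mul_le_mul_of_nonneg_left (by linarith [(abs_le.1 (h b hb0 hb1)).2]) hC.le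
    _ = ∫ y, C * b (q y) ∂μ + C * κ := by rw [integral_const_mul, mul_add]
    _ ≤ ∫ y, G y ∂μ + C * κ := add_le_add_left (integral_mono hbint hG hbG) _

theorem le_sampleMean [IsProbabilityMeasure μ] (h : IsRepresentative μ q κ x) (hn : 0 < n)
    {g G : X → ℝ} (hC : 0 < C) (hg0 : ∀ y, 0 ≤ g y) (hgC : ∀ y, g y ≤ C) (hG : Integrable G μ)
    (hGg : ∀ y z, q z = q y → G y ≤ g z) : ∫ y, G y ∂μ - C * κ ≤ sampleMean x g := by
  have hflip := h.sampleMean_le (g := fun y => C - g y) (G := fun y => C - G y) hC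
    (fun y => sub_nonneg.2 (hgC y)) (fun y => sub_le_self C (hg0 y))
    ((integrable_const C).sub hG) fun y z hyz => sub_le_sub_left (hGg y z hyz) C
  rw [sampleMean_const_sub hn, integral_sub (integrable_const C) hG, integral_const,
    probReal_univ, one_smul] at hflip
  linarith

end IsRepresentative

variable [MeasurableSingletonClass X]

theorem integral_normalizedCount_range (hx : Function.Injective x) (g : X → ℝ) :
    ∫ p, g p.1 ∂(normalizedCount (Set.range x)) = sampleMean x g := by
  have : Fintype (Set.range x) := Fintype.ofFinite _
  have hcard : Nat.card (Set.range x) = n := by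
    rw [Nat.card_range_of_injective hx, Nat.card_fin]
  rw [normalizedCount, integral_smul_measure, integral_count, hcard,
    ← (Equiv.ofInjective x hx).sum_comp]
  simp [sampleMean, div_eq_inv_mul]

namespace IsRepresentative

theorem abs_normalizedCount_real_sub_le (h : IsRepresentative μ q κ x) (hx : Function.Injective x)
    (T : Set Z) :
    |(normalizedCount (Set.range x)).real {p | q p.1 ∈ T} - μ.real (q ⁻¹' T)| ≤ κ := by
  rw [← integral_indicator_one (toFinite _).measurableSet,
    ← integral_indicator_one (q.measurableSet_preimage T)]
  have hmean := integral_normalizedCount_range hx fun y => T.indicator (1 : Z → ℝ) (q y)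
  have hT := h (T.indicator 1) (fun _ => indicator_nonneg (fun _ _ => zero_le_one) _)
    (fun _ => indicator_le_self' (fun _ _ => zero_le_one) _)
  rwa [← hmean] at hT

variable [IsFiniteMeasure μ]

theorem prokhorovLE_normalizedCount (h : IsRepresentative μ q κ x) (hx : Function.Injective x) :
    ProkhorovLE (normalizedCount (Set.range x)) μ {p | q p.1.1 = q p.2} κ := by
  intro A
  set T : Set Z := q '' (Subtype.val '' A)
  have hT : SetRel.image {p : Set.range x × X | q p.1.1 = q p.2} A = q ⁻¹' T := by
    ext y
    simp [SetRel.image, T]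
  have hle := (abs_le.1 (h.abs_normalizedCount_real_sub_le hx T)).2
  calc normalizedCount (Set.range x) A
      ≤ normalizedCount (Set.range x) {p | q p.1 ∈ T} :=
        measure_mono fun p hp => ⟨p, ⟨p, hp, rfl⟩, rfl⟩
    _ ≤ ENNReal.ofReal (μ.real (q ⁻¹' T) + κ) := by
        rw [← ofReal_measureReal]
        exact ENNReal.ofReal_le_ofReal (by linarith)
    _ = _ := by rw [ENNReal.ofReal_add measureReal_nonneg h.nonneg, ofReal_measureReal, hT]

theorem normalizedCount_prokhorovLE (h : IsRepresentative μ q κ x) (hx : Function.Injective x) :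
    ProkhorovLE μ (normalizedCount (Set.range x)) (Prod.swap ⁻¹' {p | q p.1.1 = q p.2}) κ := by
  intro B
  set T : Set Z := q '' B
  have hT : SetRel.image (Prod.swap ⁻¹' {p : Set.range x × X | q p.1.1 = q p.2}) B =
      {p | q p.1 ∈ T} := by
    ext p
    simp [SetRel.image, T, eq_comm]
  have hle := (abs_le.1 (h.abs_normalizedCount_real_sub_le hx T)).1
  calc μ B ≤ μ (q ⁻¹' T) := measure_mono (subset_preimage_image q B)
    _ ≤ ENNReal.ofReal ((normalizedCount (Set.range x)).real {p | q p.1 ∈ T} + κ) := by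
        rw [← ofReal_measureReal]
        exact ENNReal.ofReal_le_ofReal (by linarith)
    _ = _ := by rw [ENNReal.ofReal_add measureReal_nonneg h.nonneg, ofReal_measureReal, hT]

end IsRepresentative

end RepresentativeSample

section Compact

open TopologicalSpace (denseSeq denseRange_denseSeq)

variable {X : Type*} [MetricSpace X] [CompactSpace X] [MeasurableSpace X]

theorem exists_forall_ofReal_lt_measure_ball (μ : Measure X) [μ.IsOpenPosMeasure] {ρ : ℝ}
    (hρ : 0 < ρ) : ∃ m : ℝ, 0 < m ∧ ∀ y, ENNReal.ofReal m < μ (Metric.ball y ρ) := by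
  have hlocal : ∀ y : X, ∃ m : ℝ, 0 < m ∧ ENNReal.ofReal m < μ (Metric.ball y (ρ / 2)) := by
    intro y
    have hpos := Metric.measure_ball_pos μ y (half_pos hρ)
    obtain ⟨m, -, hm, hmy⟩ := ENNReal.lt_iff_exists_real_btwn.1 hpos
    exact ⟨m, ENNReal.ofReal_pos.1 hm, hmy⟩
  have huniv := isCompact_univ.induction_on
    (p := fun s : Set X => ∃ m : ℝ, 0 < m ∧ ∀ y ∈ s, ENNReal.ofReal m < μ (Metric.ball y ρ))
    ⟨1, one_pos, fun _ h => h.elim⟩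
    (fun s t hst ⟨m, hm, h⟩ => ⟨m, hm, fun y hy => h y (hst hy)⟩)
    (fun s t ⟨m, hm, h⟩ ⟨m', hm', h'⟩ => ⟨min m m', lt_min hm hm', ?_⟩)
    fun y _ => ?_
  · simpa using huniv
  · rintro y (hy | hy)
    · exact (ENNReal.ofReal_le_ofReal (min_le_left _ _)).trans_lt (h y hy)
    · exact (ENNReal.ofReal_le_ofReal (min_le_right _ _)).trans_lt (h' y hy)
  · obtain ⟨m, hm, h⟩ := hlocal y
    refine ⟨Metric.ball y (ρ / 2),
      mem_nhdsWithin_of_mem_nhds (Metric.ball_mem_nhds y (half_pos hρ)), m, hm,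
      fun z hz => h.trans_le (measure_mono (Metric.ball_subset_ball' ?_))⟩
    linarith [Metric.mem_ball'.1 hz]

variable [OpensMeasurableSpace X]

theorem exists_forall_measure_closedBall_le (μ : Measure X) [IsFiniteMeasure μ]
    [NullSingletonClass μ] {η : ENNReal} (hη : 0 < η) :
    ∃ a : ℝ, 0 < a ∧ ∀ y, μ (Metric.closedBall y a) ≤ η := by
  have huniv := isCompact_univ.induction_on
    (p := fun s : Set X => ∃ a : ℝ, 0 < a ∧ ∀ y ∈ s, μ (Metric.closedBall y a) ≤ η)
    ⟨1, one_pos, fun _ h => h.elim⟩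
    (fun s t hst ⟨a, ha, h⟩ => ⟨a, ha, fun y hy => h y (hst hy)⟩)
    (fun s t ⟨a, ha, h⟩ ⟨a', ha', h'⟩ => ⟨min a a', lt_min ha ha', ?_⟩)
    fun y _ => ?_
  · simpa using huniv
  · rintro y (hy | hy)
    · exact (measure_mono (Metric.closedBall_subset_closedBall (min_le_left _ _))).trans (h y hy)
    · exact (measure_mono (Metric.closedBall_subset_closedBall (min_le_right _ _))).trans (h' y hy)
  · have hlim : Tendsto (fun a => μ (Metric.cthickening a {y})) (𝓝 0) (𝓝 (μ {y})) :=
      tendsto_measure_cthickening_of_isClosed ⟨1, one_pos, measure_ne_top μ _⟩ isClosed_singleton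
    rw [measure_singleton] at hlim
    obtain ⟨a, ha, ha0⟩ := ((((hlim.mono_left nhdsWithin_le_nhds).eventually
      (ge_mem_nhds hη)).and (self_mem_nhdsWithin (s := Ioi 0)))).exists
    have ha0 : 0 < a := ha0
    rw [Metric.cthickening_singleton y ha0.le] at ha
    refine ⟨Metric.ball y (a / 2), mem_nhdsWithin_of_mem_nhds
      (Metric.ball_mem_nhds y (half_pos ha0)), a / 2, half_pos ha0, fun z hz =>
        (measure_mono (Metric.closedBall_subset_closedBall' ?_)).trans ha⟩
    linarith [Metric.mem_ball.1 hz]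

theorem exists_simpleFunc_forall_eq_imp_dist_le [Nonempty X] {ρ : ℝ} (hρ : 0 < ρ) :
    ∃ q : SimpleFunc X X, ∀ y z, q y = q z → dist y z ≤ ρ := by
  obtain ⟨t, ht⟩ := isCompact_univ.elim_finite_subcover
    (fun k : ℕ => Metric.ball (denseSeq X k) (ρ / 2)) (fun _ => Metric.isOpen_ball)
    fun y _ => mem_iUnion.2 ((denseRange_denseSeq X).exists_dist_lt y (half_pos hρ))
  have hnear : ∀ y, dist (SimpleFunc.nearestPt (denseSeq X) (t.sup id) y) y ≤ ρ / 2 := by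
    intro y
    obtain ⟨k, hk, hyk⟩ := mem_iUnion₂.1 (ht (mem_univ y))
    have hle := SimpleFunc.edist_nearestPt_le (denseSeq X) y (Finset.le_sup (f := id) hk)
    rw [id, edist_dist, edist_dist, ENNReal.ofReal_le_ofReal_iff dist_nonneg] at hle
    exact hle.trans (Metric.mem_ball'.1 hyk).le
  refine ⟨SimpleFunc.nearestPt (denseSeq X) (t.sup id), fun y z hyz => ?_⟩
  have hz := hnear z
  rw [← hyz] at hz
  linarith [hnear y, dist_triangle_left y z (SimpleFunc.nearestPt (denseSeq X) (t.sup id) y)]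

end Compact

section DensityMeasure

variable {d : ℕ} {f : E d → ℝ}

theorem map_val_densityMeasure :
    (densityMeasure f).map Subtype.val = volume.withDensity fun x => ENNReal.ofReal (f x) := by
  have hsupp := (isClosed_tsupport f).measurableSet
  rw [densityMeasure, (MeasurableEmbedding.subtype_coe hsupp).map_comap, Subtype.range_coe]
  refine Measure.restrict_eq_self_of_ae_mem ?_
  change (volume.withDensity fun x => ENNReal.ofReal (f x)) (tsupport f)ᶜ = 0
  rw [withDensity_apply _ hsupp.compl]
  refine setLIntegral_eq_zero hsupp.compl fun x hx => ?_
  simp [image_eq_zero_of_notMem_tsupport hx]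

theorem densityMeasure_preimage {A : Set (E d)} (hA : MeasurableSet A) :
    densityMeasure f (Subtype.val ⁻¹' A) = ∫⁻ x in A, ENNReal.ofReal (f x) := by
  rw [← Measure.map_apply measurable_subtype_coe hA, map_val_densityMeasure,
    withDensity_apply _ hA]

theorem isProbabilityMeasure_densityMeasure (hf : IsProbabilityDensity f) :
    IsProbabilityMeasure (densityMeasure f) := by
  refine ⟨?_⟩
  rw [← preimage_univ (f := Subtype.val), densityMeasure_preimage .univ, Measure.restrict_univ,
    ← ofReal_integral_eq_lintegral_ofReal hf.integrable (ae_of_all _ hf.nonneg),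
    hf.integral_eq_one, ENNReal.ofReal_one]

theorem nullSingletonClass_densityMeasure (hd : 0 < d) :
    NullSingletonClass (densityMeasure f) := by
  refine ⟨fun y => ?_⟩
  have : Nonempty (Fin d) := ⟨⟨0, hd⟩⟩
  have hy : ({y} : Set (tsupport f)) = Subtype.val ⁻¹' {(y : E d)} := by
    ext z
    simp [Subtype.ext_iff]
  rw [hy, densityMeasure_preimage (measurableSet_singleton _)]
  simp

theorem integral_densityMeasure (hcont : Continuous f) (h0 : ∀ x, 0 ≤ f x) {g : E d → ℝ}
    (hg : Measurable g) : ∫ y, g y ∂(densityMeasure f) = ∫ x, f x * g x := by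
  have hmeas : Measurable fun x => ENNReal.ofReal (f x) :=
    ENNReal.measurable_ofReal.comp hcont.measurable
  rw [← integral_map (f := g) measurable_subtype_coe.aemeasurable hg.aestronglyMeasurable,
    map_val_densityMeasure, integral_withDensity_eq_integral_toReal_smul hmeas
      (ae_of_all _ fun x => ENNReal.ofReal_lt_top)]
  simp [ENNReal.toReal_ofReal (h0 _)]

theorem isOpenPosMeasure_densityMeasure (hcont : Continuous f) (h0 : ∀ x, 0 ≤ f x) :
    (densityMeasure f).IsOpenPosMeasure := by
  refine ⟨fun U hU ⟨y, hy⟩ => ?_⟩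
  obtain ⟨V, hV, rfl⟩ := isOpen_induced_iff.1 hU
  obtain ⟨z, hzV, hz⟩ := mem_closure_iff.1 y.2 V hV hy
  have hfz : 0 < f z := (h0 z).lt_of_ne' hz
  have hmeas : Measurable fun x => ENNReal.ofReal (f x) :=
    ENNReal.measurable_ofReal.comp hcont.measurable
  rw [densityMeasure_preimage hV.measurableSet, ← withDensity_apply _ hV.measurableSet, Ne,
    withDensity_apply_eq_zero hmeas]
  have hopen : IsOpen ({x | ENNReal.ofReal (f x) ≠ 0} ∩ V) :=
    (isOpen_ne_fun (ENNReal.continuous_ofReal.comp hcont) continuous_const).inter hV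
  exact (hopen.measure_pos _ ⟨z, by simpa using hfz, hzV⟩).ne'

end DensityMeasure

namespace DensityKernel

variable {d : ℕ} {K : DensityKernel}

theorem le_apply_zero (K : DensityKernel) {r : ℝ} (hr : 0 ≤ r) : K r ≤ K 0 :=
  K.antitoneOn self_mem_Ici hr hr

theorem le_add_indicator (K : DensityKernel) {X : Type*} {A : Set X} {y : X} {u v : ℝ} (hu : 0 ≤ u)
    (hv : 0 ≤ v) (h : y ∉ A → u ≤ v) : K v ≤ K u + A.indicator (fun _ => K 0) y := by
  by_cases hy : y ∈ A
  · rw [indicator_of_mem hy]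
    linarith [K.nonneg u hu, K.le_apply_zero hv]
  · rw [indicator_of_notMem hy, add_zero]
    exact K.antitoneOn hu hv (h hy)

namespace FiniteVolume

theorem exists_setIntegral_tail_le (hK : K.FiniteVolume d) {δ : ℝ} (hδ : 0 < δ) :
    ∃ W : ℝ, 0 < W ∧ ∫ w in {w : E d | W < ‖w‖}, K ‖w‖ ≤ δ := by
  have hanti : Antitone fun n : ℕ => {w : E d | (n : ℝ) < ‖w‖} :=
    fun m n hmn w (hw : (n : ℝ) < ‖w‖) => (Nat.cast_le.2 hmn).trans_lt hw
  have hlim := tendsto_setIntegral_of_antitone (μ := volume) (f := fun w : E d => K ‖w‖)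
    (fun n : ℕ => measurableSet_lt (measurable_const (a := (n : ℝ))) measurable_norm) hanti
    ⟨0, hK.integrableOn⟩
  have hempty : ⋂ n : ℕ, {w : E d | (n : ℝ) < ‖w‖} = ∅ := by
    refine eq_empty_of_forall_notMem fun w hw => ?_
    obtain ⟨n, hn⟩ := exists_nat_ge ‖w‖
    exact (mem_iInter.1 hw n).not_ge hn
  rw [hempty, setIntegral_empty] at hlim
  obtain ⟨n, htail, hn⟩ := ((hlim.eventually (ge_mem_nhds hδ)).and (eventually_gt_atTop 0)).exists
  exact ⟨n, Nat.cast_pos.2 hn, htail⟩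

theorem abs_integral_mul_le (hK : K.FiniteVolume d) {g : E d → ℝ} {C W η : ℝ}
    (hC : ∀ w, |g w| ≤ C) (hη0 : 0 ≤ η) (hη : ∀ w, ‖w‖ ≤ W → |g w| ≤ η) :
    |∫ w, g w * K ‖w‖| ≤
      η * kernelVolume d K 1 + C * ∫ w in {w : E d | W < ‖w‖}, K ‖w‖ := by
  have hmeas : MeasurableSet {w : E d | W < ‖w‖} :=
    measurableSet_lt measurable_const measurable_norm
  have hcore : Integrable fun w : E d => η * K ‖w‖ := hK.const_mul η
  have htail := (hK.indicator hmeas).const_mul C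
  have hle : ∀ w, |g w * K ‖w‖| ≤
      η * K ‖w‖ + C * {w : E d | W < ‖w‖}.indicator (fun w => K ‖w‖) w := by
    intro w
    have hKw := K.nonneg _ (norm_nonneg w)
    rw [abs_mul, abs_of_nonneg hKw]
    by_cases hw : W < ‖w‖
    · rw [indicator_of_mem (by exact hw)]
      linarith [mul_le_mul_of_nonneg_right (hC w) hKw, mul_nonneg hη0 hKw]
    · rw [indicator_of_notMem (by exact hw), mul_zero, add_zero]
      exact mul_le_mul_of_nonneg_right (hη w (not_lt.1 hw)) hKw
  refine (norm_integral_le_of_norm_le (f := fun w => g w * K ‖w‖) (hcore.add htail)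
    (ae_of_all _ hle)).trans_eq ?_
  rw [integral_add' hcore htail, integral_const_mul, integral_const_mul, integral_indicator hmeas]
  simp only [kernelVolume, div_one]

end FiniteVolume

end DensityKernel

section KernelSmoothing

variable {d : ℕ} {K : DensityKernel}

theorem kernelVolume_mul {c s : ℝ} (hc : 0 < c) (hs : 0 < s) :
    kernelVolume d K (c * s) = c ^ d * kernelVolume d K s := by
  rw [kernelVolume_eq d K (mul_pos hc hs), kernelVolume_eq d K hs, mul_pow, mul_assoc]

theorem kernelVolume_le_kernelVolume (hK : K.FiniteVolume d) {s s' : ℝ} (hs : 0 < s)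
    (hss' : s ≤ s') : kernelVolume d K s ≤ kernelVolume d K s' := by
  rw [kernelVolume_eq d K hs, kernelVolume_eq d K (hs.trans_le hss')]
  exact mul_le_mul_of_nonneg_right (pow_le_pow_left₀ hs.le hss' d) (kernelVolume_one_pos hK).le

theorem integral_mul_kernel_dist_div (f : E d → ℝ) (K : DensityKernel) {s : ℝ} (hs : 0 < s)
    (p : E d) :
    ∫ y, f y * K (dist p y / s) = s ^ d * ∫ w, f (p + s • w) * K ‖w‖ := by
  have hscale := Measure.integral_comp_inv_smul_of_nonneg (volume : Measure (E d))
    (fun w => f (p + s • w) * K ‖w‖) hs.le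
  rw [finrank_euclideanSpace, Fintype.card_fin, smul_eq_mul] at hscale
  rw [← hscale, ← integral_add_left_eq_self (fun y => f y * K (dist p y / s)) p]
  simp only [dist_self_add_right, smul_inv_smul₀ hs.ne', norm_smul, norm_inv,
    Real.norm_of_nonneg hs.le, div_eq_inv_mul]

theorem exists_forall_abs_integral_mul_kernel_sub_le (hK : K.FiniteVolume d) {f : E d → ℝ}
    (huc : UniformContinuous f) {M : ℝ} (hM : ∀ x, |f x| ≤ M) {δ : ℝ} (hδ : 0 < δ) :
    ∃ b : ℝ, 0 < b ∧ ∀ s, 0 < s → s ≤ b → ∀ p : E d,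
      |(∫ y, f y * K (dist p y / s)) - kernelVolume d K s * f p| ≤ δ * kernelVolume d K s := by
  have hv := kernelVolume_one_pos hK
  have hM0 : 0 ≤ M := (abs_nonneg _).trans (hM 0)
  obtain ⟨W, hW, htail⟩ := hK.exists_setIntegral_tail_le
    (δ := δ * kernelVolume d K 1 / 2 / (2 * M + 1)) (by positivity)
  obtain ⟨a, ha, hfa⟩ := Metric.uniformContinuous_iff.1 huc (δ / 2) (half_pos hδ)
  refine ⟨a / W / 2, by positivity, fun s hs hsb p => ?_⟩
  have hsW : s * W < a := (lt_div_iff₀ hW).1 (hsb.trans_lt (half_lt_self (by positivity)))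
  have hnear : ∀ w : E d, ‖w‖ ≤ W → |f (p + s • w) - f p| ≤ δ / 2 := by
    intro w hw
    refine (hfa ?_).le
    rw [dist_self_add_left, norm_smul, Real.norm_of_nonneg hs.le]
    exact (mul_le_mul_of_nonneg_left hw hs.le).trans_lt hsW
  have hbound : ∀ w : E d, |f (p + s • w) - f p| ≤ 2 * M := fun w =>
    (abs_sub _ _).trans (by linarith [hM (p + s • w), hM p])
  have hint : Integrable fun w : E d => f (p + s • w) * K ‖w‖ :=
    hK.bdd_mul (huc.continuous.comp (by fun_prop)).aestronglyMeasurable (ae_of_all _ fun w => hM _)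
  have hdiff : (∫ y, f y * K (dist p y / s)) - kernelVolume d K s * f p =
      s ^ d * ∫ w : E d, (f (p + s • w) - f p) * K ‖w‖ := by
    simp only [sub_mul]
    rw [integral_sub hint (hK.const_mul _), integral_const_mul, integral_mul_kernel_dist_div f K hs,
      kernelVolume_eq d K hs]
    simp only [kernelVolume, div_one]
    ring
  rw [hdiff, abs_mul, abs_of_pos (pow_pos hs d), kernelVolume_eq d K hs, mul_left_comm]
  refine mul_le_mul_of_nonneg_left ?_ (pow_nonneg hs.le d)
  calc |∫ w : E d, (f (p + s • w) - f p) * K ‖w‖|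
      ≤ δ / 2 * kernelVolume d K 1 + 2 * M * ∫ w in {w : E d | W < ‖w‖}, K ‖w‖ :=
        hK.abs_integral_mul_le hbound (half_pos hδ).le hnear
    _ ≤ δ / 2 * kernelVolume d K 1 +
          (2 * M + 1) * (δ * kernelVolume d K 1 / 2 / (2 * M + 1)) := by
        gcongr
        · exact setIntegral_nonneg (measurableSet_lt measurable_const measurable_norm)
            fun w _ => K.nonneg _ (norm_nonneg w)
        · linarith
    _ = δ * kernelVolume d K 1 := by field_simp; ring

end KernelSmoothing

namespace IsRepresentative

variable {X Z : Type*} [MetricSpace X] [MeasurableSpace X] [BorelSpace X] {μ : Measure X}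
  [IsProbabilityMeasure μ] {q : SimpleFunc X Z} {κ ρ a s lam : ℝ} {n : ℕ} {x : Fin n → X}

theorem localDensity_normalizedCount_le (h : IsRepresentative μ q κ x)
    (hx : Function.Injective x) (hq : ∀ y z, q y = q z → dist y z ≤ ρ) (K : DensityKernel)
    (hs : 0 < s) (hlam : 1 < lam) (ha : ρ * lam ≤ a * (lam - 1)) (p : Set.range x) :
    localDensity K (normalizedCount (Set.range x)) s p ≤
      localDensity K μ (lam * s) p + K 0 * (μ.real (Metric.closedBall p a) + κ) := by
  have hlam0 : 0 < lam := one_pos.trans hlam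
  have hball := Metric.isClosed_closedBall (x := p.1) (ε := a) |>.measurableSet
  have hK : Integrable (fun y => K (dist p.1 y / (lam * s))) μ :=
    K.integrable_comp μ (by fun_prop) fun y => by positivity
  have hind := (integrable_const (μ := μ) (K 0)).indicator hball
  have hpoint : ∀ y z, q z = q y → K (dist p.1 z / s) ≤
      K (dist p.1 y / (lam * s)) + (Metric.closedBall p.1 a).indicator (fun _ => K 0) y := by
    refine fun y z hyz => K.le_add_indicator (by positivity) (by positivity) fun hy => ?_
    have hya : a < dist p.1 y := by rwa [Metric.mem_closedBall', not_le] at hy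
    have hyz' : dist p.1 y - ρ ≤ dist p.1 z := by
      linarith [dist_triangle p.1 z y, hq z y hyz]
    rw [← div_div]
    refine div_le_div_of_nonneg_right ((div_le_iff₀ hlam0).2 ?_) hs.le
    nlinarith
  calc localDensity K (normalizedCount (Set.range x)) s p
      = sampleMean x fun y => K (dist p.1 y / s) :=
        integral_normalizedCount_range hx fun y => K (dist p.1 y / s)
    _ ≤ ∫ y, (K (dist p.1 y / (lam * s)) +
          (Metric.closedBall p.1 a).indicator (fun _ => K 0) y) ∂μ + K 0 * κ :=
        h.sampleMean_le K.zero_pos (fun y => K.nonneg _ (by positivity))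
          (fun y => K.le_apply_zero (by positivity)) (hK.add hind) hpoint
    _ = _ := by
        rw [integral_add hK hind, integral_indicator_const _ hball, smul_eq_mul, localDensity]
        ring

theorem le_localDensity_normalizedCount (h : IsRepresentative μ q κ x)
    (hx : Function.Injective x) (hq : ∀ y z, q y = q z → dist y z ≤ ρ) (K : DensityKernel)
    (hs : 0 < s) (hlam : 1 < lam) (ha : ρ * lam ≤ a * (lam - 1)) (p : Set.range x) :
    localDensity K μ (lam⁻¹ * s) p - K 0 * (μ.real (Metric.closedBall p a) + κ) ≤
      localDensity K (normalizedCount (Set.range x)) s p := by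
  have hn : 0 < n := let ⟨i, _⟩ := p.2; i.pos
  have : 0 < lam := one_pos.trans hlam
  have hball := Metric.isClosed_closedBall (x := p.1) (ε := a) |>.measurableSet
  have hK : Integrable (fun y => K (dist p.1 y / (lam⁻¹ * s))) μ :=
    K.integrable_comp μ (by fun_prop) fun y => by positivity
  have hind := (integrable_const (μ := μ) (K 0)).indicator hball
  have hpoint : ∀ y z, q z = q y → K (dist p.1 y / (lam⁻¹ * s)) -
      (Metric.closedBall p.1 a).indicator (fun _ => K 0) y ≤ K (dist p.1 z / s) := by
    refine fun y z hyz => sub_le_iff_le_add.2 <|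
      K.le_add_indicator (by positivity) (by positivity) fun hy => ?_
    have hya : a < dist p.1 y := by rwa [Metric.mem_closedBall', not_le] at hy
    have hzy : dist p.1 z ≤ dist p.1 y + ρ := by
      linarith [dist_triangle p.1 y z, hq y z hyz.symm]
    rw [← div_div, div_inv_eq_mul]
    refine div_le_div_of_nonneg_right ?_ hs.le
    nlinarith [dist_nonneg.trans (hq y y rfl)]
  calc localDensity K μ (lam⁻¹ * s) p - K 0 * (μ.real (Metric.closedBall p a) + κ)
      = ∫ y, (K (dist p.1 y / (lam⁻¹ * s)) -
          (Metric.closedBall p.1 a).indicator (fun _ => K 0) y) ∂μ - K 0 * κ := by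
        rw [integral_sub hK hind, integral_indicator_const _ hball, smul_eq_mul, localDensity]
        ring
    _ ≤ sampleMean x fun y => K (dist p.1 y / s) :=
        h.le_sampleMean hn K.zero_pos (fun y => K.nonneg _ (by positivity))
          (fun y => K.le_apply_zero (by positivity)) (hK.sub hind) hpoint
    _ = localDensity K (normalizedCount (Set.range x)) s p :=
        (integral_normalizedCount_range hx fun y => K (dist p.1 y / s)).symm

end IsRepresentative

section DensityEstimate

variable {d : ℕ} {f : E d → ℝ} {K : DensityKernel}

theorem localDensity_densityMeasure (hcont : Continuous f) (h0 : ∀ x, 0 ≤ f x) (K : DensityKernel)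
    {s : ℝ} (hs : 0 < s) (p : tsupport f) :
    localDensity K (densityMeasure f) s p = ∫ y, f y * K (dist p.1 y / s) :=
  integral_densityMeasure hcont h0 (g := fun y => K (dist p.1 y / s))
    (K.measurable_comp (by fun_prop) fun y => by positivity)

theorem exists_one_lt_pow_mul_le (d : ℕ) {u v : ℝ} (huv : u < v) :
    ∃ lam : ℝ, 1 < lam ∧ lam ≤ 2 ∧ lam ^ d * u ≤ v := by
  have hlim : Tendsto (fun l : ℝ => l ^ d * u) (𝓝[>] 1) (𝓝 (1 ^ d * u)) :=
    (Continuous.tendsto (by fun_prop) 1).mono_left nhdsWithin_le_nhds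
  rw [one_pow, one_mul] at hlim
  obtain ⟨lam, hle, hlam⟩ :=
    ((hlim.eventually (ge_mem_nhds huv)).and (Ioc_mem_nhdsGT one_lt_two)).exists
  exact ⟨lam, hlam.1, hlam.2, hle⟩

theorem exists_forall_localDensity_densityMeasure_le (hK : K.FiniteVolume d)
    (huc : UniformContinuous f) (h0 : ∀ x, 0 ≤ f x) {M : ℝ} (hM : ∀ x, f x ≤ M) {δ : ℝ}
    (hδ : 0 < δ) :
    ∃ lam b : ℝ, 1 < lam ∧ 0 < b ∧ ∀ s, 0 < s → s ≤ b → ∀ p : tsupport f,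
      localDensity K (densityMeasure f) (lam * s) p ≤ (f p + 2 * δ) * kernelVolume d K s ∧
      (f p - 2 * δ) * kernelVolume d K s ≤ localDensity K (densityMeasure f) (lam⁻¹ * s) p := by
  obtain ⟨b, hb, hsmooth⟩ := exists_forall_abs_integral_mul_kernel_sub_le hK huc
    (fun x => (abs_of_nonneg (h0 x)).trans_le (hM x)) hδ
  obtain ⟨lam, hlam, hlam2, hpow⟩ :=
    exists_one_lt_pow_mul_le d (show M + δ < M + 2 * δ by linarith)
  have hlam0 : 0 < lam := one_pos.trans hlam
  have hL : 1 ≤ lam ^ d := one_le_pow₀ hlam.le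
  refine ⟨lam, b / 2, hlam, half_pos hb, fun s hs hsb p => ?_⟩
  have hv := (kernelVolume_pos hK hs).le
  have hfp : lam ^ d * (f p + δ) ≤ f p + 2 * δ := by nlinarith [hM p]
  have hinv : lam⁻¹ * s ≤ s := mul_le_of_le_one_left hs.le (inv_le_one_of_one_le₀ hlam.le)
  have hup := (abs_le.1 (hsmooth (lam * s) (by positivity) (by nlinarith) p)).2
  have hlow := (abs_le.1 (hsmooth (lam⁻¹ * s) (by positivity) (by linarith) p)).1
  rw [localDensity_densityMeasure huc.continuous h0 K (by positivity),
    localDensity_densityMeasure huc.continuous h0 K (by positivity)]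
  rw [kernelVolume_mul hlam0 hs] at hup
  rw [kernelVolume_mul (inv_pos.2 hlam0) hs, inv_pow] at hlow
  have hfp' : f p - 2 * δ ≤ (lam ^ d)⁻¹ * (f p - δ) := by
    rw [← div_eq_inv_mul, le_div_iff₀ (by positivity)]
    nlinarith
  exact ⟨by linarith [mul_le_mul_of_nonneg_right hfp hv],
    by linarith [mul_le_mul_of_nonneg_right hfp' hv]⟩

theorem exists_forall_mul_measureReal_closedBall_add_le {X : Type*} [MetricSpace X] [CompactSpace X]
    [MeasurableSpace X] [OpensMeasurableSpace X] (μ : Measure X) [IsFiniteMeasure μ]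
    [NullSingletonClass μ] {C η : ℝ} (hC : 0 < C) (hη : 0 < η) :
    ∃ a κ : ℝ, 0 < a ∧ 0 < κ ∧ ∀ y, C * (μ.real (Metric.closedBall y a) + κ) ≤ η := by
  have hη' : 0 < η / C / 2 := by positivity
  obtain ⟨a, ha, hball⟩ := exists_forall_measure_closedBall_le μ (ENNReal.ofReal_pos.2 hη')
  refine ⟨a, η / C / 2, ha, hη', fun y => ?_⟩
  rw [← le_div_iff₀' hC]
  linarith [show μ.real _ ≤ _ from ENNReal.toReal_le_of_le_ofReal hη'.le (hball y)]

theorem exists_forall_abs_localDensity_normalizedCount_sub_le (hd : 0 < d) (hK : K.FiniteVolume d)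
    (hf : IsProbabilityDensity f) (hcont : Continuous f) (hcomp : HasCompactSupport f) {δ : ℝ}
    (hδ : 0 < δ) :
    ∃ b : ℝ, 0 < b ∧ ∀ s₀, 0 < s₀ → ∃ ρ₀ κ₀ : ℝ, 0 < ρ₀ ∧ 0 < κ₀ ∧
      ∀ {Z : Type} (q : SimpleFunc (tsupport f) Z), (∀ y z, q y = q z → dist y z ≤ ρ₀) →
      ∀ {n : ℕ} (x : Fin n → tsupport f), Function.Injective x →
      IsRepresentative (densityMeasure f) q κ₀ x → ∀ s, s₀ ≤ s → s ≤ b → ∀ p : Set.range x,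
        |localDensity K (normalizedCount (Set.range x)) s p - f p * kernelVolume d K s| ≤
          δ * kernelVolume d K s := by
  have := isProbabilityMeasure_densityMeasure hf
  have := nullSingletonClass_densityMeasure (f := f) hd
  have : CompactSpace (tsupport f) := isCompact_iff_compactSpace.1 hcomp
  obtain ⟨M, hM⟩ := hcomp.exists_bound_of_continuous hcont
  obtain ⟨lam, b, hlam, hb, hpop⟩ := exists_forall_localDensity_densityMeasure_le hK
    (hcomp.uniformContinuous_of_continuous hcont) hf.nonneg (fun x => (le_abs_self _).trans (hM x))
    (δ := δ / 3) (by positivity)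
  refine ⟨b, hb, fun s₀ hs₀ => ?_⟩
  have hv₀ := kernelVolume_pos hK hs₀
  obtain ⟨a, κ₀, ha, hκ₀, hball⟩ := exists_forall_mul_measureReal_closedBall_add_le
    (densityMeasure f) K.zero_pos (show 0 < δ / 3 * kernelVolume d K s₀ by positivity)
  have : 0 < lam - 1 := sub_pos.2 hlam
  refine ⟨a * (lam - 1) / lam, κ₀, by positivity, hκ₀, fun q hq n x hx hrep s hs₀s hsb p => ?_⟩
  have hs := hs₀.trans_le hs₀s
  have herr : K 0 * ((densityMeasure f).real (Metric.closedBall p.1 a) + κ₀) ≤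
      δ / 3 * kernelVolume d K s :=
    (hball p.1).trans
      (mul_le_mul_of_nonneg_left (kernelVolume_le_kernelVolume hK hs₀ hs₀s) (by positivity))
  have hscale : a * (lam - 1) / lam * lam ≤ a * (lam - 1) :=
    (div_mul_cancel₀ _ (one_pos.trans hlam).ne').le
  have hup := hrep.localDensity_normalizedCount_le hx hq K hs hlam hscale p
  have hlow := hrep.le_localDensity_normalizedCount hx hq K hs hlam hscale p
  rw [abs_le]
  exact ⟨by linarith [(hpop s hs hsb p).2], by linarith [(hpop s hs hsb p).1]⟩

end DensityEstimate

section Approximation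

variable {d : ℕ} {f : E d → ℝ} {K : DensityKernel}

theorem approximatesContour_linkage_kernelFiltration {X : Set (tsupport f)} {μ : Measure X}
    {s v r δ b τ : ℝ} {t : PosReal} (hv : 0 < v)
    (hest : ∀ p : X, |localDensity K μ s p - f p.1 * v| ≤ δ * v) (htb : t.1 ≤ b) (hτt : τ ≤ t.1) :
    ApproximatesContour f (Clustering.linkage (kernelFiltration K μ s (r * v)) t) r δ b τ where
  le_of_mem p hp := by
    rw [Clustering.sUnion_linkage] at hp
    refine le_of_mul_le_mul_right ?_ hv
    linarith [show r * v ≤ localDensity K μ s p from hp, (abs_le.1 (hest p)).2]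
  mem_of_le p hp := by
    rw [Clustering.sUnion_linkage]
    change r * v ≤ localDensity K μ s p
    linarith [mul_le_mul_of_nonneg_right hp hv.le, (abs_le.1 (hest p)).1]
  isChained := (Clustering.isChained_linkage _ t).mono htb
  isSeparated := (Clustering.isSeparated_linkage _ t).mono hτt

theorem IsRepresentative.exists_dist_le {X Z : Type*} [MetricSpace X] [MeasurableSpace X]
    [MeasurableSingletonClass X] {μ : Measure X} [IsFiniteMeasure μ] {q : SimpleFunc X Z}
    {κ ρ ρ' : ℝ} {n : ℕ} {x : Fin n → X} (h : IsRepresentative μ q κ x)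
    (hx : Function.Injective x) (hq : ∀ y z, q y = q z → dist y z ≤ ρ) {y : X}
    (hy : ENNReal.ofReal κ < μ (Metric.ball y ρ')) :
    ∃ p : Set.range x, dist p.1 y ≤ ρ + ρ' := by
  obtain ⟨z, hz, p, hpz⟩ := (h.normalizedCount_prokhorovLE hx).exists_mem hy
  exact ⟨p, (dist_triangle p.1 z y).trans (add_le_add (hq _ _ hpz) (Metric.mem_ball.1 hz).le)⟩

end Approximation

namespace ParamCurve

variable {d : ℕ} {f : E d → ℝ} {K : DensityKernel}

/-- Curves on `(0, ∞)` for which the density threshold at `r` is `r` times the kernel volume at the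
bandwidth at `r`, so that slicing at `r` thresholds the kernel density estimate at the value `r`. -/
structure IsDensityNormalized (c : ParamCurve) (d : ℕ) (K : DensityKernel) : Prop where
  max_eq_top : c.max = ⊤
  k_eq : ∀ r, 0 < r → c.k r = r * kernelVolume d K (c.s r)

theorem isDensityNormalized_reparam {γ : ParamCurve} (hd : 0 < d) (hγ : γ.Covering)
    (hK : K.FiniteVolume d) : (γ.reparam hd hγ hK).IsDensityNormalized d K where
  max_eq_top := rfl
  k_eq r hr := by
    have hmem := phiInv_mem hd hγ hK hr
    exact (div_eq_iff (kernelVolume_pos hK (γ.s_pos _ hmem.1 hmem.2)).ne').1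
      (phi_phiInv hd hγ hK hr)

namespace IsDensityNormalized

variable {c : ParamCurve}

theorem lt_max (hc : c.IsDensityNormalized d K) (r : ℝ) : (r : EReal) < c.max :=
  hc.max_eq_top ▸ EReal.coe_lt_top r

theorem approximatesContour_slice_kernelLinkage (hc : c.IsDensityNormalized d K)
    (hK : K.FiniteVolume d) {X : Set (tsupport f)} {μ : Measure X} [IsFiniteMeasure μ]
    {r δ b τ : ℝ} (hr : 0 < r)
    (hest : ∀ p : X, |localDensity K μ (c.s r) p - f p.1 * kernelVolume d K (c.s r)| ≤
      δ * kernelVolume d K (c.s r)) (htb : c.t r ≤ b) (hτt : τ ≤ c.t r) :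
    ApproximatesContour f ((c.slice (kernelLinkage K μ)).at' r hr) r δ b τ := by
  have hslice : (c.slice (kernelLinkage K μ)).at' r hr =
      Clustering.linkage (kernelFiltration K μ (c.s r) (c.k r))
        ⟨c.t r, c.t_pos r hr (hc.lt_max r)⟩ := dif_pos (hc.lt_max r)
  rw [hslice, hc.k_eq r hr]
  exact approximatesContour_linkage_kernelFiltration
    (kernelVolume_pos hK (c.s_pos r hr (hc.lt_max r))) hest htb hτt

theorem measuredInterleavedWrt_slice_kernelLinkage (hc : c.IsDensityNormalized d K)
    (hK : K.FiniteVolume d) (hf : IsProbabilityDensity f) (hcont : Continuous f) {M ε b ρ κ : ℝ}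
    (hε : 0 < ε) (hM0 : 0 ≤ M) (hM : ∀ y, f y ≤ M)
    (hmod : ∀ y z : E d, dist y z ≤ b → |f y - f z| ≤ ε / 2) (htb : ∀ r, 0 < r → c.t r ≤ b)
    (hρ : 0 < ρ) (hρt : 3 * ρ ≤ c.t (M + ε)) {Z : Type*} {q : SimpleFunc (tsupport f) Z}
    (hq : ∀ y z, q y = q z → dist y z ≤ ρ / 2) (hκε : κ ≤ ε)
    (hball : ∀ y, ENNReal.ofReal κ < densityMeasure f (Metric.ball y (ρ / 2)))
    {n : ℕ} {x : Fin n → tsupport f} (hn : 0 < n) (hx : Function.Injective x)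
    (hrep : IsRepresentative (densityMeasure f) q κ x)
    (hest : ∀ r, 0 < r → r ≤ M + ε → ∀ p : Set.range x,
      |localDensity K (normalizedCount (Set.range x)) (c.s r) p - f p * kernelVolume d K (c.s r)| ≤
        ε / 2 * kernelVolume d K (c.s r)) :
    MeasuredInterleavedWrt (normalizedCount (Set.range x)) (densityMeasure f)
      (c.slice (kernelLinkage K (normalizedCount (Set.range x)))) (densityContour f)
      (closestPointCorrespondence (fun p : Set.range x => (p.1 : E d))
        (fun y : tsupport f => (y : E d))) ε ε := by
  have := isProbabilityMeasure_densityMeasure hf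
  have : Nonempty (Set.range x) := ⟨⟨x ⟨0, hn⟩, mem_range_self _⟩⟩
  have hr₀ : 0 < M + ε := by positivity
  have hdom (r) (hr : 0 < r) : r ∈ c.dom := ⟨hr, hc.lt_max r⟩
  have hρb : ρ ≤ b := by linarith [htb _ hr₀]
  have hqρ (y z) (h : q y = q z) : dist y z ≤ ρ := (hq y z h).trans (half_le_self hρ.le)
  refine measuredInterleavedWrt_densityContour (δ := ε / 2) hcont (half_pos hε) (by linarith) hM0
    hM hρ hρb hmod (fun r hr hrM => ?_) (fun y => ?_)
    ((hrep.prokhorovLE_normalizedCount hx).mono (fun p h => hqρ _ _ h) hκε)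
    ((hrep.normalizedCount_prokhorovLE hx).mono (fun p h => hqρ _ _ h) hκε)
  · exact hc.approximatesContour_slice_kernelLinkage hK hr (hest r hr hrM) (htb r hr)
      (hρt.trans (c.t_anti (hdom r hr) (hdom _ hr₀) hrM))
  · obtain ⟨p, hp⟩ := hrep.exists_dist_le hx hq (hball y)
    exact ⟨p, hp.trans_eq (add_halves ρ)⟩

theorem exists_measuredInterleavedWrt_of_isRepresentative (hd : 0 < d) (hK : K.FiniteVolume d)
    (hf : IsProbabilityDensity f) (hcont : Continuous f) (hcomp : HasCompactSupport f) {ε : ℝ}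
    (hε : 0 < ε) :
    ∃ b : ℝ, 0 < b ∧ ∀ c : ParamCurve, c.IsDensityNormalized d K →
      (∀ r, 0 < r → c.s r ≤ b ∧ c.t r ≤ b) →
      ∃ (q : SimpleFunc (tsupport f) (tsupport f)) (κ : ℝ), 0 < κ ∧
        ∀ (n : ℕ) (x : Fin n → tsupport f), 0 < n → Function.Injective x →
          IsRepresentative (densityMeasure f) q κ x →
          MeasuredInterleavedWrt (normalizedCount (Set.range x)) (densityMeasure f)
            (c.slice (kernelLinkage K (normalizedCount (Set.range x)))) (densityContour f)
            (closestPointCorrespondence (fun p : Set.range x => (p.1 : E d))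
              (fun y : tsupport f => (y : E d))) ε ε := by
  have := isProbabilityMeasure_densityMeasure hf
  have := isOpenPosMeasure_densityMeasure hcont hf.nonneg
  have : Nonempty (tsupport f) := nonempty_of_isProbabilityMeasure (densityMeasure f)
  have : CompactSpace (tsupport f) := isCompact_iff_compactSpace.1 hcomp
  obtain ⟨M, hM⟩ := hcomp.exists_bound_of_continuous hcont
  have hM0 : 0 ≤ M := (norm_nonneg _).trans (hM 0)
  obtain ⟨b₁, hb₁, hdensity⟩ := exists_forall_abs_localDensity_normalizedCount_sub_le hd hK hf
    hcont hcomp (half_pos hε)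
  obtain ⟨b₂, hb₂, hmod⟩ := Metric.uniformContinuous_iff_le.1
    (hcomp.uniformContinuous_of_continuous hcont) (ε / 2) (half_pos hε)
  refine ⟨min b₁ b₂, lt_min hb₁ hb₂, fun c hc hcb => ?_⟩
  have hr₀ : 0 < M + ε := by positivity
  have hdom (r) (hr : 0 < r) : r ∈ c.dom := ⟨hr, hc.lt_max r⟩
  have ht₀ := c.t_pos _ hr₀ (hc.lt_max _)
  obtain ⟨ρ₀, κ₀, hρ₀, hκ₀, hest⟩ := hdensity (c.s (M + ε)) (c.s_pos _ hr₀ (hc.lt_max _))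
  set ρ := min ρ₀ (c.t (M + ε) / 3)
  have hρ : 0 < ρ := by positivity
  obtain ⟨m, hm, hball⟩ := exists_forall_ofReal_lt_measure_ball (densityMeasure f) (half_pos hρ)
  obtain ⟨q, hq⟩ := exists_simpleFunc_forall_eq_imp_dist_le (X := tsupport f) (half_pos hρ)
  refine ⟨q, min κ₀ (min ε m), by positivity, fun n x hn hx hrep => ?_⟩
  have hκm : min κ₀ (min ε m) ≤ m := (min_le_right _ _).trans (min_le_right _ _)
  refine hc.measuredInterleavedWrt_slice_kernelLinkage hK hf hcont hε hM0
    (fun y => (le_abs_self _).trans (hM y)) (fun y z h => hmod h)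
    (fun r hr => (hcb r hr).2.trans (min_le_right _ _)) hρ
    (by linarith [min_le_right ρ₀ (c.t (M + ε) / 3)]) hq
    ((min_le_right _ _).trans (min_le_left _ _))
    (fun y => (ENNReal.ofReal_le_ofReal hκm).trans_lt (hball y)) hn hx hrep fun r hr hrM => ?_
  exact hest q (fun y z h => (hq y z h).trans ((half_le_self hρ.le).trans (min_le_left _ _))) x hx
    (hrep.mono (min_le_left _ _)) (c.s r) (c.s_anti (hdom r hr) (hdom _ hr₀) hrM)
    ((hcb r hr).1.trans (min_le_left _ _))

end IsDensityNormalized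

end ParamCurve

/-- The hierarchical clustering algorithm that slices the kernel linkage of a finite metric space,
with its normalized counting measure, by the curve `c θ`. -/
noncomputable def sliceLinkage {Θ : Type*} (K : DensityKernel) (c : Θ → ParamCurve) :
    HCAlgorithm Θ :=
  fun θ X _ _ _ _ => (c θ).slice (kernelLinkage K (normalizedCount X))

section Consistency

variable {Θ : Type*} {d : ℕ} {f : E d → ℝ}

/-- The outer probability that the clustering of an `n`-sample of `densityMeasure f` is not
`ε`-measured-interleaved with the density contour of `f`. -/
noncomputable def failureProbability (𝔸 : HCAlgorithm Θ) (f : E d → ℝ) (θ : Θ) (ε : ℝ) (n : ℕ) :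
    ENNReal :=
  (Measure.pi fun _ : Fin n => densityMeasure f)
    {x : Fin n → tsupport f | ¬ MeasuredInterleavedWrt
      (normalizedCount (Set.range x)) (densityMeasure f)
      (𝔸 θ (Set.range x)) (densityContour f)
      (closestPointCorrespondence (fun p : Set.range x => (p.1 : E d))
        (fun y : tsupport f => (y : E d))) ε ε}

theorem failureProbability_antitone (𝔸 : HCAlgorithm Θ) (f : E d → ℝ) (θ : Θ) (n : ℕ) :
    Antitone fun ε => failureProbability 𝔸 f θ ε n :=
  fun _ _ hε => measure_mono fun _ hx h => hx (h.mono hε hε)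

theorem exists_seq_tendsto_atTop_eventually {Q : ℕ → ℕ → Prop} (h : ∀ k, ∀ᶠ n in atTop, Q k n) :
    ∃ κ : ℕ → ℕ, Tendsto κ atTop atTop ∧ ∀ᶠ n in atTop, Q (κ n) n := by
  classical
  set P : ℕ → ℕ → Prop := fun n k => ∀ n' ≥ n, Q k n'
  refine ⟨fun n => Nat.findGreatest (P n) n, tendsto_atTop.2 fun k => ?_, ?_⟩
  · obtain ⟨N, hN⟩ := eventually_atTop.1 (h k)
    filter_upwards [eventually_ge_atTop (max k N)] with n hn
    exact Nat.le_findGreatest ((le_max_left _ _).trans hn)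
      fun n' hn' => hN n' (((le_max_right _ _).trans hn).trans hn')
  · obtain ⟨N, hN⟩ := eventually_atTop.1 (h 0)
    filter_upwards [eventually_ge_atTop N] with n hn
    have hP : P n (Nat.findGreatest (P n) n) :=
      Nat.findGreatest_spec (m := 0) (Nat.zero_le n) fun n' hn' => hN n' (hn.trans hn')
    exact hP n le_rfl

theorem MIConsistent.of_forall_exists_tendsto_failureProbability {𝔸 : HCAlgorithm Θ}
    (h : ∀ ε, 0 < ε → ∃ θ, Tendsto (failureProbability 𝔸 f θ ε) atTop (𝓝 0)) :
    MIConsistent 𝔸 f := by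
  choose θ hθ using fun k : ℕ => h (1 / ((k : ℝ) + 1)) (by positivity)
  obtain ⟨κ, hκ, hκθ⟩ := exists_seq_tendsto_atTop_eventually fun k =>
    (hθ k).eventually (ge_mem_nhds (ENNReal.ofReal_pos.2
      (show (0 : ℝ) < 1 / ((k : ℝ) + 1) by positivity)))
  have hlim : Tendsto (fun n => 1 / ((κ n : ℝ) + 1)) atTop (𝓝 0) :=
    tendsto_one_div_add_atTop_nhds_zero_nat.comp hκ
  have hlim' : Tendsto (fun n => ENNReal.ofReal (1 / ((κ n : ℝ) + 1))) atTop (𝓝 0) :=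
    ENNReal.ofReal_zero ▸ ENNReal.tendsto_ofReal hlim
  refine ⟨fun n => θ (κ n), fun ε hε => ?_⟩
  refine tendsto_of_tendsto_of_tendsto_of_le_of_le' tendsto_const_nhds hlim'
    (Eventually.of_forall fun _ => zero_le) ?_
  filter_upwards [hκθ, hlim.eventually (gt_mem_nhds hε)] with n hn hnε
  exact (failureProbability_antitone 𝔸 f (θ (κ n)) n hnε.le).trans hn

theorem exists_forall_tendsto_failureProbability_sliceLinkage (hd : 0 < d) {K : DensityKernel}
    (hK : K.FiniteVolume d) {c : Θ → ParamCurve} (hc : ∀ θ, (c θ).IsDensityNormalized d K)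
    (hf : IsProbabilityDensity f) (hcont : Continuous f) (hcomp : HasCompactSupport f) {ε : ℝ}
    (hε : 0 < ε) :
    ∃ b : ℝ, 0 < b ∧ ∀ θ, (∀ r, 0 < r → (c θ).s r ≤ b ∧ (c θ).t r ≤ b) →
      Tendsto (failureProbability (sliceLinkage K c) f θ ε) atTop (𝓝 0) := by
  have := isProbabilityMeasure_densityMeasure hf
  have := nullSingletonClass_densityMeasure (f := f) hd
  obtain ⟨b, hb, h⟩ :=
    ParamCurve.IsDensityNormalized.exists_measuredInterleavedWrt_of_isRepresentative hd hK hf hcont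
      hcomp hε
  refine ⟨b, hb, fun θ hθ => ?_⟩
  obtain ⟨q, κ, hκ, hinterleaved⟩ := h (c θ) (hc θ) hθ
  refine tendsto_of_tendsto_of_tendsto_of_le_of_le' tendsto_const_nhds
    (tendsto_pi_not_isRepresentative (μ := densityMeasure f) q hκ)
    (Eventually.of_forall fun _ => zero_le) ?_
  filter_upwards [eventually_gt_atTop 0] with n hn
  calc failureProbability (sliceLinkage K c) f θ ε n
      ≤ (Measure.pi fun _ : Fin n => densityMeasure f) ({x | ¬ Function.Injective x} ∪
          {x | ¬ IsRepresentative (densityMeasure f) q κ x}) :=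
        measure_mono fun x hx => not_and_or.1 fun hgood =>
          hx (hinterleaved n x hn hgood.1 hgood.2)
    _ ≤ _ := (measure_union_le _ _).trans_eq (by rw [pi_not_injective_eq_zero, zero_add])

end Consistency

end GammaLinkage

theorem mainTheorem4_general {d : ℕ} (hd : 0 < d) {K : GammaLinkage.DensityKernel}
    (hK : K.FiniteVolume d) {Θ : Type*} (c : Θ → GammaLinkage.ParamCurve)
    (hc : ∀ θ, (c θ).IsDensityNormalized d K)
    (hsmall : ∀ b : ℝ, 0 < b → ∃ θ, ∀ r, 0 < r → (c θ).s r ≤ b ∧ (c θ).t r ≤ b)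
    (f : GammaLinkage.E d → ℝ) (hf : GammaLinkage.IsProbabilityDensity f) (hcont : Continuous f)
    (hcomp : HasCompactSupport f) :
    GammaLinkage.MIConsistent (GammaLinkage.sliceLinkage K c) f := by
  refine GammaLinkage.MIConsistent.of_forall_exists_tendsto_failureProbability fun ε hε => ?_
  obtain ⟨b, hb, h⟩ := GammaLinkage.exists_forall_tendsto_failureProbability_sliceLinkage hd hK hc
    hf hcont hcomp hε
  exact (hsmall b hb).imp h

theorem mainTheorem4 {d : ℕ} (hd : 0 < d) {K : GammaLinkage.DensityKernel}
    (hK : K.FiniteVolume d) {Θ : Type*} (γ : Θ → GammaLinkage.ParamCurve)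
    (hγ : GammaLinkage.AdmissibleFamily γ) (f : GammaLinkage.E d → ℝ)
    (hf : GammaLinkage.IsProbabilityDensity f) (hcont : Continuous f)
    (hcomp : HasCompactSupport f) :
    GammaLinkage.MIConsistent (GammaLinkage.gammaBarLinkage hd hK γ hγ) f :=
  mainTheorem4_general hd hK (fun θ => (γ θ).reparam hd (hγ.covering θ) hK)
    (fun θ => GammaLinkage.ParamCurve.isDensityNormalized_reparam hd (hγ.covering θ) hK)
    (fun b hb => (hγ.small b hb).imp fun θ hθ _ hr =>
      (hθ _ (GammaLinkage.ParamCurve.phiInv_mem hd (hγ.covering θ) hK hr)).imp le_of_lt le_of_lt)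
    f hf hcont hcomp
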